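/- Let $N$ be a non-negative integer, $K$ a field, $X=(x_1,\dots,x_{N-1})$ and $Y=(y_1,\dots,y_{N-2})$ sequences in $K$. The Okada algebra $O_N(X,Y)$ is the unital associative $K$-algebra generated by $E_1,\dots,E_{N-1}$ with relations $E_i^2=x_iE_i$, $E_iE_j=E_jE_i$ for $|i-j|\ge 2$, and $E_{i+1}E_iE_{i+1}=y_iE_{i+1}$ for $1\le i\le N-2$. For $\sigma\in\mathfrak S_N$ let $\ell(\sigma)$ be its number of inversions, let $c_i=\#\{j<i : \sigma^{-1}(j)>\sigma^{-1}(i)\}$, and put $E_\sigma=\prod_{i=1}^N E_{i-1}E_{i-2}\cdots E_{i-c_i}$ (factors written from left to right, $i$ increasing). A Fibonacci set of rank $N$ is a set $S=\{s_1<\dots<s_k\}\subseteq\{1,\dots,N\}$ with $k\equiv N$ and $s_l\equiv l \pmod 2$ for all $l$. Its free set is $\mathfrak F(S)=\{i\in\{1,\dots,N\}\setminus S : i-\max\{s\in S: s<i\}\text{ is odd}\}$ (with $\max\emptyset=0$), and its free element is $E_S=\prod_{i\in\mathfrak F(S)}E_i$ (the factors commute). For Fibonacci sets $S=\{s_1<\dots<s_k\}$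 and $T=\{t_1<\dots<t_m\}$ of rank $N$, write $S\preceq T$ if $k\le m$ and $s_{k-i}\le t_{m-i}$ for $0\le i<k$; this is a partial order, and $\inf$ denotes infima with respect to it. To each $E_\sigma$ belongs a height-labelled arc-diagram on the nodes $1,\dots,N$ (left) and $\overline1,\dots,\overline N$ (right), obtained by replacing each $E_i$ in the product by the elementary diagram $G_i$ with arcs $\{j,\overline j\}$ labelled $j$ ($j\ne i,i+1$), $\{i,i+1\}$ labelled $i$ and $\{\overline i,\overline{i+1}\}$ labelled $i$ (the empty product being the diagram with arcs $\{j,\overline j\}$ labelled $j$, $1\le j\le N$). Diagrams are composed by merging the right nodes of the first with the left nodes of the second, discarding loops, and giving each concatenated arc the minimum of the labels of its fragments. $\mathrm{PropLab}(E_\sigma)$ is the set of labels of the arcs of this diagram that join a left node to a right node. **Theorem (Triangular Factorization).** For every $\sigma\in\mathfrak S_N$ the set $S=\mathrm{PropLab}(E_\sigma)$ is a Fibonacci set of rank $N$, and there is a unique pair of permutations $\rho,\tau\in\mathfrak S_N$ such that $$E_\sigma=E_\rho\cdot E_S\cdot E_\tau\quad\text{in } O_N(X,Y)\qquad\text{and}\qquad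 \ell(\sigma)=\#\mathfrak F(S)+\ell(\rho)+\ell(\tau).$$ Moreover, for this pair, $\mathrm{PropLab}(E_\rho)$ and $\mathrm{PropLab}(E_\tau)$ are Fibonacci sets of rank $N$, their infimum exists, and $S\preceq\inf(\mathrm{PropLab}(E_\rho),\mathrm{PropLab}(E_\tau))$. -/

import Mathlib

/-! ## Fibonacci sets and the dominance order -/

/-- A Fibonacci set of rank `N`: a subset `{s₁ < ⋯ < s_k}` of `{1, …, N}` with `k ≡ N (mod 2)`
and `s_l ≡ l (mod 2)` for all `l`. The position of `s` in the set is `#{t ∈ S | t ≤ s}`. -/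
@[ext]
structure FibonacciSet (N : ℕ) where
  carrier : Finset ℕ
  subset_Icc : carrier ⊆ Finset.Icc 1 N
  card_parity : carrier.card ≡ N [MOD 2]
  elem_parity : ∀ s ∈ carrier, s ≡ (carrier.filter (fun t => t ≤ s)).card [MOD 2]

namespace FibonacciSet

/-- The elements in decreasing order: entry number `i` (counted from `0`) is `s_{k-i}`. -/
def desc {N : ℕ} (S : FibonacciSet N) : List ℕ := S.carrier.sort (fun a b => a ≥ b)

theorem length_desc {N : ℕ} (S : FibonacciSet N) : S.desc.length = S.carrier.card :=
  Finset.length_sort _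

/-- `S` is dominated by `T`: `k ≤ l` and `s_{k-i} ≤ t_{l-i}` for `0 ≤ i < k`,
where `k = #S` and `l = #T`. -/
def Dominated {N : ℕ} (S T : FibonacciSet N) : Prop :=
  S.carrier.card ≤ T.carrier.card ∧
    ∀ i < S.carrier.card, S.desc.getD i 0 ≤ T.desc.getD i 0

instance instPartialOrder (N : ℕ) : PartialOrder (FibonacciSet N) where
  le S T := Dominated S T
  le_refl _ := ⟨le_rfl, fun _ _ => le_rfl⟩
  le_trans _ _ _ h₁ h₂ :=
    ⟨h₁.1.trans h₂.1, fun i hi => (h₁.2 i hi).trans (h₂.2 i (hi.trans_le h₁.1))⟩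
  le_antisymm S T h₁ h₂ := by
    have hc : S.carrier.card = T.carrier.card := le_antisymm h₁.1 h₂.1
    have hd : S.desc = T.desc := by
      refine List.ext_getElem (by rw [length_desc, length_desc, hc]) ?_
      intro i hi hi'
      have a := h₁.2 i (by rwa [← length_desc])
      have b := h₂.2 i (by rwa [← length_desc])
      rw [List.getD_eq_getElem _ _ hi, List.getD_eq_getElem _ _ hi'] at a b
      exact le_antisymm a b
    ext x
    have hS : x ∈ S.desc ↔ x ∈ S.carrier := Finset.mem_sort _
    have hT : x ∈ T.desc ↔ x ∈ T.carrier := Finset.mem_sort _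
    rw [← hS, ← hT, hd]

/-- The free set `𝔉(S)`: those `i ∈ {1, …, N} \ S` for which `i - max {s ∈ S | s < i}` is odd,
with the convention `max ∅ = 0`. -/
def freeSet {N : ℕ} (S : FibonacciSet N) : Finset ℕ :=
  (Finset.Icc 1 N).filter
    (fun i => i ∉ S.carrier ∧ Odd (i - (S.carrier.filter (fun s => s < i)).sup id))

end FibonacciSet

/-! ## Permutations

A permutation of `{1, …, N}` is an element of `Equiv.Perm (Fin N)`, where `k : Fin N` stands for
the number `k + 1`. -/

/-- The number of inversions of `σ`, that is, its Coxeter length. -/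
def permLength {N : ℕ} (σ : Equiv.Perm (Fin N)) : ℕ :=
  (Finset.univ.filter (fun p : Fin N × Fin N => p.1 < p.2 ∧ σ p.2 < σ p.1)).card

/-- The code of `σ`: `c_i = #{j < i | σ⁻¹ j > σ⁻¹ i}`. -/
def permCode {N : ℕ} (σ : Equiv.Perm (Fin N)) (i : Fin N) : ℕ :=
  (Finset.univ.filter (fun j : Fin N => j < i ∧ σ.symm i < σ.symm j)).card

/-- The word of indices `∏_{i = 1}^{N} (i-1) (i-2) ⋯ (i-c_i)`, read from left to right.
All its letters lie in `{1, …, N - 1}`. -/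
def permWord {N : ℕ} (σ : Equiv.Perm (Fin N)) : List ℕ :=
  (List.finRange N).flatMap (fun i => (List.range (permCode σ i)).map (fun k => (i : ℕ) - k))

theorem permCode_le {N : ℕ} (σ : Equiv.Perm (Fin N)) (i : Fin N) : permCode σ i ≤ i := by
  calc permCode σ i ≤ (Finset.Iio i).card :=
        Finset.card_le_card (fun j hj => by
          rw [Finset.mem_filter] at hj
          exact Finset.mem_Iio.2 hj.2.1)
    _ = i := Fin.card_Iio i

theorem permWord_range {N : ℕ} (σ : Equiv.Perm (Fin N)) :
    ∀ m ∈ permWord σ, 1 ≤ m ∧ m < N := by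
  intro m hm
  obtain ⟨i, -, hi⟩ := List.mem_flatMap.1 hm
  obtain ⟨k, hk, rfl⟩ := List.mem_map.1 hi
  have h₁ := List.mem_range.1 hk
  have h₂ := permCode_le σ i
  have h₃ := i.isLt
  omega

/-! ## The Okada algebra

Generators are indexed by `Fin (N - 1)`, where `k` stands for the generator `E_{k+1}`; likewise
`X k` is the parameter `x_{k+1}` and `Y k` is the parameter `y_{k+1}`. -/

/-- The defining relations of the Okada algebra. -/
inductive OkadaRel {K : Type*} [Field K] (N : ℕ) (X : Fin (N - 1) → K) (Y : Fin (N - 2) → K) :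
    FreeAlgebra K (Fin (N - 1)) → FreeAlgebra K (Fin (N - 1)) → Prop
  | idem (i : Fin (N - 1)) :
      OkadaRel N X Y (FreeAlgebra.ι K i * FreeAlgebra.ι K i) (X i • FreeAlgebra.ι K i)
  | comm (i j : Fin (N - 1)) (h : (i : ℕ) + 2 ≤ j) :
      OkadaRel N X Y (FreeAlgebra.ι K i * FreeAlgebra.ι K j)
        (FreeAlgebra.ι K j * FreeAlgebra.ι K i)
  | shift (i j : Fin (N - 1)) (k : Fin (N - 2)) (hi : (i : ℕ) = k) (hj : (j : ℕ) = k + 1) :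
      OkadaRel N X Y (FreeAlgebra.ι K j * FreeAlgebra.ι K i * FreeAlgebra.ι K j)
        (Y k • FreeAlgebra.ι K j)

/-- The Okada algebra of rank `N` with parameters `X`, `Y`. -/
abbrev OkadaAlgebra {K : Type*} [Field K] (N : ℕ) (X : Fin (N - 1) → K) (Y : Fin (N - 2) → K) :=
  RingQuot (OkadaRel N X Y)

/-- The generator `E_i` for `1 ≤ i ≤ N - 1` (and, as a dummy value, `1` for other `i`). -/
noncomputable def okadaGen {K : Type*} [Field K] (N : ℕ) (X : Fin (N - 1) → K)
    (Y : Fin (N - 2) → K) (i : ℕ) : OkadaAlgebra N X Y :=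
  if h : 1 ≤ i ∧ i < N then
    RingQuot.mkAlgHom K (OkadaRel N X Y) (FreeAlgebra.ι K (⟨i - 1, by omega⟩ : Fin (N - 1)))
  else 1

/-- The basis element `E_σ = ∏_{i = 1}^{N} E_{i-1} E_{i-2} ⋯ E_{i-c_i}`. -/
noncomputable def okadaPerm {K : Type*} [Field K] (N : ℕ) (X : Fin (N - 1) → K)
    (Y : Fin (N - 2) → K) (σ : Equiv.Perm (Fin N)) : OkadaAlgebra N X Y :=
  ((permWord σ).map (okadaGen N X Y)).prod

/-- The free element `E_S`, the product of the (pairwise commuting) `E_i` with `i ∈ 𝔉(S)`. -/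
noncomputable def okadaFree {K : Type*} [Field K] (N : ℕ) (X : Fin (N - 1) → K)
    (Y : Fin (N - 2) → K) (S : FibonacciSet N) : OkadaAlgebra N X Y :=
  ((S.freeSet.sort (fun a b => a ≤ b)).map (okadaGen N X Y)).prod

/-! ## Height-labelled arc-diagrams

A height-labelled arc-diagram of rank `N` is recorded by its set of arcs `(s(a, b), h)`, where `h`
is the height label and `a`, `b` are boundary nodes: `Sum.inl k` is the left node `k + 1` and
`Sum.inr k` is the right node `k + 1` (with a bar). -/

/-- A set of height-labelled arcs on the `2N` boundary nodes. -/
abbrev LabelledArcs (N : ℕ) := Set (Sym2 (Fin N ⊕ Fin N) × ℕ)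

namespace LabelledArcs

/-- The nodes of a concatenation: left, middle (where the two diagrams are merged) and right. -/
inductive GluedNode (N : ℕ) : Type
  | left (k : Fin N)
  | mid (k : Fin N)
  | right (k : Fin N)

/-- The nodes of the first diagram, placed in the concatenation. -/
def fstNode {N : ℕ} : Fin N ⊕ Fin N → GluedNode N
  | Sum.inl k => GluedNode.left k
  | Sum.inr k => GluedNode.mid k

/-- The nodes of the second diagram, placed in the concatenation. -/
def sndNode {N : ℕ} : Fin N ⊕ Fin N → GluedNode N
  | Sum.inl k => GluedNode.mid k
  | Sum.inr k => GluedNode.right k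

/-- The boundary nodes of the concatenation. -/
def outerNode {N : ℕ} : Fin N ⊕ Fin N → GluedNode N
  | Sum.inl k => GluedNode.left k
  | Sum.inr k => GluedNode.right k

/-- `C` or `D` has an arc fragment with label `h` that joins the nodes `u` and `v`. -/
def Fragment {N : ℕ} (C D : LabelledArcs N) (u v : GluedNode N) (h : ℕ) : Prop :=
  (∃ a b, (s(a, b), h) ∈ C ∧ u = fstNode a ∧ v = fstNode b) ∨
    (∃ a b, (s(a, b), h) ∈ D ∧ u = sndNode a ∧ v = sndNode b)

/-- `u` and `v` lie on the same concatenated arc (or loop). -/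
def Linked {N : ℕ} (C D : LabelledArcs N) : GluedNode N → GluedNode N → Prop :=
  Relation.ReflTransGen (fun u v => ∃ h, Fragment C D u v h)

/-- The composition: two distinct boundary nodes form an arc if they are linked, and its label is
the minimum of the labels of the fragments that make it up. Loops are discarded. -/
def comp {N : ℕ} (C D : LabelledArcs N) : LabelledArcs N :=
  {p | ∃ a b, a ≠ b ∧ p.1 = s(a, b) ∧ Linked C D (outerNode a) (outerNode b) ∧
    IsLeast {h | ∃ u v, Linked C D (outerNode a) u ∧ Fragment C D u v h} p.2}

/-- The identity diagram: propagating arcs from `a` to `a` (with a bar), with label `a`. -/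
def identity (N : ℕ) : LabelledArcs N :=
  {p | ∃ j : Fin N, p = (s(Sum.inl j, Sum.inr j), (j : ℕ) + 1)}

/-- The elementary diagram `G_i`, for `1 ≤ i < N`: arcs from `j` to `j` (with a bar) with label `j`
for `j ≠ i, i + 1`, and on either side an arc from `i` to `i + 1` with label `i`. -/
def elementary (N i : ℕ) : LabelledArcs N :=
  {p | (∃ j : Fin N, (j : ℕ) + 1 ≠ i ∧ (j : ℕ) + 1 ≠ i + 1 ∧
          p = (s(Sum.inl j, Sum.inr j), (j : ℕ) + 1)) ∨
       (∃ a b : Fin N, (a : ℕ) + 1 = i ∧ (b : ℕ) + 1 = i + 1 ∧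
          (p = (s(Sum.inl a, Sum.inl b), i) ∨ p = (s(Sum.inr a, Sum.inr b), i)))}

/-- The Okada arc-diagram of `E_σ`, i.e. its image under the identification `E_i ↦ G_i` of the
Okada algebra with the diagram algebra: the product `∏_{i = 1}^{N} G_{i-1} G_{i-2} ⋯ G_{i-c_i}`.
This product of diagrams is free of loops and it does not depend on the parameters. -/
def ofPerm {N : ℕ} (σ : Equiv.Perm (Fin N)) : LabelledArcs N :=
  ((permWord σ).map (elementary N)).foldr comp (identity N)

/-- The set of height labels of the propagating arcs, those joining a left and a right node. -/
def propLab {N : ℕ} (D : LabelledArcs N) : Set ℕ :=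
  {h | ∃ a b : Fin N, (s(Sum.inl a, Sum.inr b), h) ∈ D}

end LabelledArcs

/-!
The words of permutations are the reduced words, up to commuting letters that differ by at least
`2`. Over any parameters, the Okada algebra acts on words in normal form, and this action recovers
the commutation class of a reduced word from its image among all words of the same length. So the
factorization, its lengths and its uniqueness are questions about words up to commutation.

The top letter `N - 1` occurs at most once in a reduced word. Peeling off on the left the run that
ascends to it, and then on the right the run that descends from the next lower letter, leaves a word
whose letters commute with the top letter; by induction this word factors through a free word, which
the top letter joins. The outer factors turn towards the free word only letters at its level, and
this property makes the factorization unique.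

Multiplying the diagram of the free word of `S` by such outer factors joins nodes within one side
without changing any propagating label, so these labels form `S`. Since a composition of diagrams
has, for every `x`, at most as many propagating labels `≥ x` as either factor, `S` is dominated by
the sets of both outer factors.
-/

/-! ## Words up to commutation -/

/-- The subword of `w` formed by the letters `c` and `c + 1`. -/
def adjFilter (c : ℕ) (w : List ℕ) : List ℕ := w.filter (fun x => x = c ∨ x = c + 1)

/-- Equality of words up to commutation of letters that differ by at least `2`. By the projection
lemma for trace monoids this amounts to equality of all the subwords on two adjacent letters, which
is taken as the definition. -/
def TraceEq (u v : List ℕ) : Prop := ∀ c, adjFilter c u = adjFilter c v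

/-- Reduced words: between any two occurrences of a letter `c` there is a letter `c + 1`. These are
the words that no relation of the Okada algebra shortens. -/
def ReducedWord (w : List ℕ) : Prop := ∀ c, ¬ [c, c] <:+: adjFilter c w

@[simp] theorem adjFilter_nil (c : ℕ) : adjFilter c [] = [] := rfl

@[simp] theorem adjFilter_append (c : ℕ) (u v : List ℕ) :
    adjFilter c (u ++ v) = adjFilter c u ++ adjFilter c v := by simp [adjFilter]

theorem adjFilter_cons (c a : ℕ) (u : List ℕ) :
    adjFilter c (a :: u) = if a = c ∨ a = c + 1 then a :: adjFilter c u else adjFilter c u := by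
  simp [adjFilter, List.filter_cons]

theorem adjFilter_cons_self (c : ℕ) (u : List ℕ) : adjFilter c (c :: u) = c :: adjFilter c u := by
  simp [adjFilter_cons]

theorem adjFilter_cons_succ (c : ℕ) (u : List ℕ) :
    adjFilter c ((c + 1) :: u) = (c + 1) :: adjFilter c u := by
  simp [adjFilter_cons]

theorem adjFilter_reverse (c : ℕ) (u : List ℕ) :
    adjFilter c u.reverse = (adjFilter c u).reverse := by simp [adjFilter]

theorem mem_adjFilter {c a : ℕ} {u : List ℕ} :
    a ∈ adjFilter c u ↔ a ∈ u ∧ (a = c ∨ a = c + 1) := by simp [adjFilter]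

theorem adjFilter_eq_nil {c : ℕ} {u : List ℕ} (h : ∀ a ∈ u, a ≠ c ∧ a ≠ c + 1) :
    adjFilter c u = [] := by
  simpa [adjFilter] using h

theorem adjFilter_eq_nil_of_lt {c : ℕ} {u : List ℕ} (h : ∀ a ∈ u, a < c) : adjFilter c u = [] :=
  adjFilter_eq_nil fun a ha => ⟨(h a ha).ne, ((h a ha).trans (Nat.lt_succ_self c)).ne⟩

theorem count_adjFilter_self (c : ℕ) (u : List ℕ) : (adjFilter c u).count c = u.count c :=
  List.count_filter (by simp)

theorem count_adjFilter_succ (c : ℕ) (u : List ℕ) :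
    (adjFilter c u).count (c + 1) = u.count (c + 1) :=
  List.count_filter (by simp)

namespace TraceEq

@[refl] theorem refl (u : List ℕ) : TraceEq u u := fun _ => rfl

@[symm] theorem symm {u v : List ℕ} (h : TraceEq u v) : TraceEq v u := fun c => (h c).symm

@[trans] theorem trans {u v w : List ℕ} (h : TraceEq u v) (h' : TraceEq v w) : TraceEq u w :=
  fun c => (h c).trans (h' c)

instance : Trans TraceEq TraceEq TraceEq := ⟨trans⟩

theorem append {u v u' v' : List ℕ} (h : TraceEq u u') (h' : TraceEq v v') :
    TraceEq (u ++ v) (u' ++ v') := fun c => by simp [h c, h' c]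

theorem append_left {v v' : List ℕ} (u : List ℕ) (h' : TraceEq v v') :
    TraceEq (u ++ v) (u ++ v') := (refl u).append h'

theorem append_right {u u' : List ℕ} (h : TraceEq u u') (v : List ℕ) :
    TraceEq (u ++ v) (u' ++ v) := h.append (refl v)

theorem of_append_left {u v v' : List ℕ} (h : TraceEq (u ++ v) (u ++ v')) : TraceEq v v' :=
  fun c => by simpa using h c

theorem reverse {u v : List ℕ} (h : TraceEq u v) : TraceEq u.reverse v.reverse := fun c => by
  rw [adjFilter_reverse, adjFilter_reverse, h c]

theorem perm {u v : List ℕ} (h : TraceEq u v) : u.Perm v := by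
  rw [List.perm_iff_count]
  intro a
  rw [← count_adjFilter_self, h a, count_adjFilter_self]

theorem mem_iff {u v : List ℕ} (h : TraceEq u v) (a : ℕ) : a ∈ u ↔ a ∈ v := h.perm.mem_iff

theorem append_comm {u v : List ℕ} (h : ∀ a ∈ u, ∀ b ∈ v, a + 2 ≤ b ∨ b + 2 ≤ a) :
    TraceEq (u ++ v) (v ++ u) := by
  intro c
  rw [adjFilter_append, adjFilter_append]
  by_cases hu : adjFilter c u = []
  · rw [hu, List.nil_append, List.append_nil]
  · obtain ⟨a, ha⟩ := List.exists_mem_of_ne_nil _ hu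
    rw [mem_adjFilter] at ha
    have hv : adjFilter c v = [] := adjFilter_eq_nil fun b hb => by
      have := h a ha.1 b hb
      omega
    rw [hv, List.nil_append, List.append_nil]

theorem reducedWord {u v : List ℕ} (h : TraceEq u v) (hu : ReducedWord u) : ReducedWord v :=
  fun c => by rw [← h c]; exact hu c

theorem far_of_cons_append {a : ℕ} {u v₁ v₂ : List ℕ} (h : TraceEq (a :: u) (v₁ ++ a :: v₂))
    (ha : a ∉ v₁) {b : ℕ} (hb : b ∈ v₁) : a + 2 ≤ b ∨ b + 2 ≤ a := by
  by_contra hnear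
  obtain ⟨c, hac, hbc⟩ : ∃ c, (a = c ∨ a = c + 1) ∧ (b = c ∨ b = c + 1) :=
    ⟨min a b, by omega, by omega⟩
  have hfirst := h c
  rw [adjFilter_cons, if_pos hac, adjFilter_append] at hfirst
  obtain ⟨d, l, hd⟩ := List.exists_cons_of_ne_nil
    (List.ne_nil_of_mem (mem_adjFilter.2 ⟨hb, hbc⟩))
  rw [hd, List.cons_append, List.cons.injEq] at hfirst
  have had : a ∈ adjFilter c v₁ := by rw [hd, hfirst.1]; exact List.mem_cons_self
  exact ha (mem_adjFilter.1 had).1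

theorem exists_eq_append_cons {a : ℕ} {u v : List ℕ} (h : TraceEq (a :: u) v) :
    ∃ v₁ v₂, v = v₁ ++ a :: v₂ ∧ (∀ b ∈ v₁, a + 2 ≤ b ∨ b + 2 ≤ a) ∧ TraceEq u (v₁ ++ v₂) := by
  have hmem : a ∈ v := (h.mem_iff a).1 List.mem_cons_self
  obtain ⟨v₁, v₂, rfl, hv⟩ := List.eq_append_cons_of_mem hmem
  have hfar : ∀ b ∈ v₁, a + 2 ≤ b ∨ b + 2 ≤ a := fun b hb => h.far_of_cons_append hv hb
  have hcomm : TraceEq (v₁ ++ [a]) ([a] ++ v₁) := append_comm fun b hb a' ha' => by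
    rw [List.mem_singleton.1 ha']
    exact (hfar b hb).symm
  refine ⟨v₁, v₂, rfl, hfar, of_append_left (u := [a]) ?_⟩
  simpa using h.trans (by simpa using hcomm.append_right v₂)

theorem prod_map_eq {M : Type*} [Monoid M] {f : ℕ → M}
    (hf : ∀ a b, a + 2 ≤ b → Commute (f a) (f b)) {u v : List ℕ} (h : TraceEq u v) :
    (u.map f).prod = (v.map f).prod := by
  induction u generalizing v with
  | nil => rw [h.perm.nil_eq]
  | cons a u ih =>
    obtain ⟨v₁, v₂, rfl, hfar, h'⟩ := h.exists_eq_append_cons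
    have hcomm : Commute (f a) (v₁.map f).prod := by
      refine Commute.list_prod_right _ _ fun y hy => ?_
      obtain ⟨b, hb, rfl⟩ := List.mem_map.1 hy
      exact (hfar b hb).elim (hf a b) fun hba => (hf b a hba).symm
    rw [List.map_cons, List.prod_cons, ih h']
    simp only [List.map_append, List.prod_append, List.map_cons, List.prod_cons]
    rw [← mul_assoc, hcomm.eq, mul_assoc]

end TraceEq

namespace ReducedWord

theorem of_infix {u w : List ℕ} (hw : ReducedWord w) (h : u <:+: w) : ReducedWord u :=
  fun c hc => hw c (hc.trans (h.filter _))

theorem of_append_left {u v : List ℕ} (h : ReducedWord (u ++ v)) : ReducedWord u :=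
  h.of_infix (List.prefix_append u v).isInfix

theorem of_append_right {u v : List ℕ} (h : ReducedWord (u ++ v)) : ReducedWord v :=
  h.of_infix (List.suffix_append u v).isInfix

theorem reverse {w : List ℕ} (h : ReducedWord w) : ReducedWord w.reverse := by
  intro c hc
  rw [adjFilter_reverse, ← List.reverse_infix, List.reverse_reverse] at hc
  exact h c (by simpa using hc)

theorem nil : ReducedWord [] := fun c => by simp

theorem not_append_cons_cons {c : ℕ} {u v w : List ℕ} (hv : adjFilter c v = []) :
    ¬ ReducedWord (u ++ c :: (v ++ c :: w)) := fun h =>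
  h c ⟨adjFilter c u, adjFilter c w, by simp [adjFilter_cons_self, hv]⟩

theorem cons {a : ℕ} {w : List ℕ} (h : ReducedWord w) (ha : ¬ [a] <+: adjFilter a w) :
    ReducedWord (a :: w) := by
  intro c hc
  rw [adjFilter_cons] at hc
  split_ifs at hc with hac
  · rcases List.infix_cons_iff.1 hc with hp | hi
    · rw [List.cons_prefix_cons] at hp
      exact ha (hp.1 ▸ hp.2)
    · exact h c hi
  · exact h c hc

theorem notMem_of_append_cons {a : ℕ} {u v : List ℕ} (h : ReducedWord (u ++ a :: v))
    (hv : ∀ b ∈ v, b ≤ a) : a ∉ v := by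
  intro hav
  obtain ⟨v₁, v₂, rfl, hv₁⟩ := List.eq_append_cons_of_mem hav
  refine not_append_cons_cons (adjFilter_eq_nil_of_lt fun b hb => ?_) h
  exact (hv b (by simp [hb])).lt_of_ne fun e => hv₁ (e ▸ hb)

/-- By reducedness the top letter occurs at most once, so it suffices to normalize the part in front
of it; what the run `m, …, n - 1` leaves over there commutes with `n`. -/
theorem exists_traceEq_Ico_append {n : ℕ} {w : List ℕ} (h : ReducedWord w)
    (hw : ∀ i ∈ w, 1 ≤ i ∧ i < n + 1) :
    ∃ m v, 1 ≤ m ∧ m ≤ n + 1 ∧ (∀ i ∈ v, 1 ≤ i ∧ i < n) ∧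
      TraceEq w (List.Ico m (n + 1) ++ v) := by
  induction n generalizing w with
  | zero =>
    refine ⟨1, w, le_rfl, le_rfl, fun i hi => ?_, .refl _⟩
    have := hw i hi
    omega
  | succ n ih =>
    by_cases hn : n + 1 ∈ w
    · obtain ⟨a, b, rfl, hna⟩ := List.eq_append_cons_of_mem hn
      have hnb : n + 1 ∉ b := h.notMem_of_append_cons fun i hi =>
        Nat.le_of_lt_succ (hw i (by simp [hi])).2
      obtain ⟨m, v, hm, hmn, hv, ht⟩ := ih h.of_append_left fun i hi =>
        ⟨(hw i (by simp [hi])).1, (Nat.le_of_lt_succ (hw i (by simp [hi])).2).lt_of_ne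
          fun e => hna (e ▸ hi)⟩
      have hcomm : TraceEq (v ++ [n + 1]) ([n + 1] ++ v) := .append_comm fun i hi j hj => by
        have := hv i hi
        have := List.mem_singleton.1 hj
        omega
      refine ⟨m, v ++ b, hm, by omega, fun i hi => ?_, ?_⟩
      · rcases List.mem_append.1 hi with hi | hi
        · have := hv i hi
          omega
        · exact ⟨(hw i (by simp [hi])).1, (Nat.le_of_lt_succ (hw i (by simp [hi])).2).lt_of_ne
            fun e => hnb (e ▸ hi)⟩
      · calc
          TraceEq (a ++ (n + 1) :: b) (List.Ico m (n + 1) ++ v ++ (n + 1) :: b) := ht.append_right _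
          TraceEq _ (List.Ico m (n + 1) ++ ((v ++ [n + 1]) ++ b)) := by simpa using .refl _
          TraceEq _ (List.Ico m (n + 1) ++ (([n + 1] ++ v) ++ b)) :=
            (hcomm.append_right b).append_left _
          TraceEq _ (List.Ico m (n + 1 + 1) ++ (v ++ b)) := by
            rw [List.Ico.succ_top hmn]
            simpa using .refl _
    · refine ⟨n + 2, w, by omega, le_rfl, fun i hi => ⟨(hw i hi).1, ?_⟩, ?_⟩
      · exact (Nat.le_of_lt_succ (hw i hi).2).lt_of_ne fun e => hn (e ▸ hi)
      · rw [List.Ico.self_empty]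
        exact .refl w

end ReducedWord

theorem not_suffix_adjFilter_Ico {a b c : ℕ} (h : c + 1 < b) :
    ¬ [c] <:+ adjFilter c (List.Ico a b) := by
  intro hs
  have hac : a ≤ c := (List.Ico.mem.1 (mem_adjFilter.1 (hs.mem (List.mem_singleton_self c))).1).1
  have hnil : adjFilter c (List.Ico (c + 2) b) = [] := adjFilter_eq_nil fun i hi => by
    have := List.Ico.mem.1 hi
    omega
  rw [← List.Ico.append_consecutive (show a ≤ c + 1 + 1 by omega) h, adjFilter_append, hnil,
    List.append_nil, List.Ico.succ_top (by omega), adjFilter_append, adjFilter_cons_succ,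
    ← List.reverse_prefix] at hs
  simp at hs

theorem ReducedWord.Ico_append {a b : ℕ} {w : List ℕ} (h : ReducedWord w)
    (hw : ∀ i ∈ w, i + 1 < b) : ReducedWord (List.Ico a b ++ w) := by
  rcases le_total b a with hab | hab
  · rwa [List.Ico.eq_nil_of_le hab]
  · induction hab using Nat.decreasingInduction with
    | self => rwa [List.Ico.self_empty]
    | of_succ a hab ih =>
      rw [List.Ico.eq_cons hab, List.cons_append]
      refine ih.cons fun hp => ?_
      rcases (Nat.succ_le_of_lt hab).eq_or_lt with rfl | hab'
      · rw [List.Ico.self_empty, List.nil_append] at hp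
        have := hw a (mem_adjFilter.1 (hp.mem (List.mem_singleton_self a))).1
        omega
      · rw [List.Ico.eq_cons hab', List.cons_append, adjFilter_cons_succ,
          List.cons_prefix_cons] at hp
        omega

theorem TraceEq.le_of_Ico_append {m m' n : ℕ} {v v' : List ℕ} (hm' : m' ≤ n + 1)
    (hv' : ∀ i ∈ v', i < n) (h : TraceEq (List.Ico m (n + 1) ++ v) (List.Ico m' (n + 1) ++ v')) :
    m' ≤ m := by
  by_contra! hlt
  obtain ⟨c, rfl⟩ : ∃ c, m' = c + 1 := ⟨m' - 1, by omega⟩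
  have hc := h c
  rw [← List.Ico.append_consecutive (show m ≤ c by omega) (show c ≤ n + 1 by omega),
    List.append_assoc, adjFilter_append, adjFilter_eq_nil_of_lt fun i hi => (List.Ico.mem.1 hi).2,
    List.nil_append, List.Ico.eq_cons (by omega), List.cons_append, adjFilter_cons_self] at hc
  rcases hm'.eq_or_lt with hcn | hcn
  · have hnil : adjFilter c v' = [] :=
      adjFilter_eq_nil_of_lt fun i hi => (hv' i hi).trans_eq (by omega)
    simp [hcn, hnil] at hc
  · simp only [List.Ico.eq_cons hcn, List.cons_append, adjFilter_cons_succ, List.cons.injEq] at hc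
    omega

theorem TraceEq.Ico_append_inj {m m' n : ℕ} {v v' : List ℕ} (hm : m ≤ n + 1) (hm' : m' ≤ n + 1)
    (hv : ∀ i ∈ v, i < n) (hv' : ∀ i ∈ v', i < n)
    (h : TraceEq (List.Ico m (n + 1) ++ v) (List.Ico m' (n + 1) ++ v')) :
    m = m' ∧ TraceEq v v' := by
  obtain rfl : m = m' := le_antisymm (h.symm.le_of_Ico_append hm hv) (h.le_of_Ico_append hm' hv')
  exact ⟨rfl, h.of_append_left⟩

/-! ## Permutations and their words -/

/-- The word with the blocks `n - c (n - 1), …, n - 1`, then `n - 1 - c (n - 2), …, n - 2`, and so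
on down to a block of length `c 0` that ends in `0`. For the code `c` of a permutation it is the
reverse of the word of the permutation, see `codeWord_permCode`. -/
def codeWord (c : ℕ → ℕ) : ℕ → List ℕ
  | 0 => []
  | n + 1 => List.Ico (n + 1 - c n) (n + 1) ++ codeWord c n

theorem codeWord_congr {c c' : ℕ → ℕ} {n : ℕ} (h : ∀ i < n, c i = c' i) :
    codeWord c n = codeWord c' n := by
  induction n with
  | zero => rfl
  | succ n ih => rw [codeWord, codeWord, ih fun i hi => h i (by omega), h n n.lt_succ_self]

theorem lt_of_mem_codeWord {c : ℕ → ℕ} {n a : ℕ} (ha : a ∈ codeWord c n) : a < n := by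
  induction n with
  | zero => simp [codeWord] at ha
  | succ n ih =>
    rcases List.mem_append.1 ha with ha | ha
    · exact (List.Ico.mem.1 ha).2
    · exact (ih ha).trans n.lt_succ_self

theorem reducedWord_codeWord (c : ℕ → ℕ) (n : ℕ) : ReducedWord (codeWord c n) := by
  induction n with
  | zero => exact .nil
  | succ n ih => exact ih.Ico_append fun a ha => Nat.succ_lt_succ (lt_of_mem_codeWord ha)

theorem eq_of_traceEq_codeWord {c c' : ℕ → ℕ} {n : ℕ} (hc : ∀ i, c i ≤ i) (hc' : ∀ i, c' i ≤ i)
    (h : TraceEq (codeWord c n) (codeWord c' n)) : ∀ i < n, c i = c' i := by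
  induction n with
  | zero => simp
  | succ n ih =>
    have hcn := hc n
    have hcn' := hc' n
    obtain ⟨hm, ht⟩ := h.Ico_append_inj (Nat.sub_le _ _) (Nat.sub_le _ _)
      (fun a => lt_of_mem_codeWord) (fun a => lt_of_mem_codeWord)
    intro i hi
    rcases (Nat.lt_succ_iff.1 hi).eq_or_lt with rfl | hi
    · omega
    · exact ih ht i hi

theorem ReducedWord.exists_codeWord {n : ℕ} {w : List ℕ} (h : ReducedWord w)
    (hw : ∀ i ∈ w, 1 ≤ i ∧ i < n) : ∃ c : ℕ → ℕ, (∀ i, c i ≤ i) ∧ TraceEq w (codeWord c n) := by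
  induction n generalizing w with
  | zero =>
    obtain rfl : w = [] := List.eq_nil_iff_forall_not_mem.2 fun i hi => by simpa using hw i hi
    exact ⟨fun _ => 0, fun _ => Nat.zero_le _, .refl _⟩
  | succ n ih =>
    obtain ⟨m, v, hm, hmn, hv, ht⟩ := h.exists_traceEq_Ico_append hw
    obtain ⟨c, hc, hcv⟩ := ih (ht.reducedWord h).of_append_right hv
    refine ⟨Function.update c n (n + 1 - m), fun i => ?_, ?_⟩
    · rw [Function.update_apply]
      have := hc i
      split_ifs <;> omega
    · rw [codeWord, Function.update_self, Nat.sub_sub_self hmn,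
        codeWord_congr (c' := c) fun i hi => Function.update_of_ne hi.ne _ _]
      exact ht.trans (hcv.append_left _)

theorem permLength_eq_sum_permCode {N : ℕ} (σ : Equiv.Perm (Fin N)) :
    permLength σ = ∑ i, permCode σ i := by
  simp only [permLength, permCode]
  rw [← Finset.card_sigma]
  refine Finset.card_bij' (fun p _ => ⟨σ p.1, σ p.2⟩) (fun p _ => (σ.symm p.1, σ.symm p.2))
    ?_ ?_ ?_ ?_
  · simp +contextual
  · simp +contextual
  · simp
  · simp

theorem length_permWord {N : ℕ} (σ : Equiv.Perm (Fin N)) :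
    (permWord σ).length = permLength σ := by
  rw [permLength_eq_sum_permCode, permWord, List.length_flatMap, ← List.ofFn_eq_map, List.sum_ofFn]
  simp

theorem perm_eq_of_lt_iff_lt {N : ℕ} {π π' : Equiv.Perm (Fin N)}
    (h : ∀ i j, π j < π i ↔ π' j < π' i) : π = π' := by
  have card_lt (π : Equiv.Perm (Fin N)) (i : Fin N) :
      (π i : ℕ) = (Finset.univ.filter (π · < π i)).card := by
    rw [← Fin.card_Iio (π i)]
    refine Finset.card_bij' (fun j _ => π.symm j) (fun j _ => π j) ?_ ?_ ?_ ?_ <;> simp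
  ext i
  simp only [card_lt, h]

theorem lt_iff_lt_of_inversion_iff {α β : Type*} [LinearOrder α] [LinearOrder β] {f g : α → β}
    (hf : f.Injective) (hg : g.Injective) {i j : α} (hij : j < i → (f i < f j ↔ g i < g j))
    (hji : i < j → (f j < f i ↔ g j < g i)) : f i < f j ↔ g i < g j := by
  rcases lt_trichotomy j i with h | rfl | h
  · exact hij h
  · simp
  · rw [← not_le, ← not_le, (hf.ne h.ne').le_iff_lt, (hg.ne h.ne').le_iff_lt, hji h]

theorem filter_eq_filter_of_card_eq {α β : Type*} [LinearOrder β] {s : Finset α} {p q : α → Prop}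
    [DecidablePred p] [DecidablePred q] {f : α → β}
    (hp : ∀ a ∈ s, ∀ b ∈ s, f a ≤ f b → p a → p b) (hq : ∀ a ∈ s, ∀ b ∈ s, f a ≤ f b → q a → q b)
    (h : (s.filter p).card = (s.filter q).card) : s.filter p = s.filter q := by
  by_cases hpq : s.filter p ⊆ s.filter q
  · exact Finset.eq_of_subset_of_card_le hpq h.ge
  · refine (Finset.eq_of_subset_of_card_le (fun b hb => ?_) h.le).symm
    obtain ⟨a, ha, haq⟩ := Finset.not_subset.1 hpq
    simp only [Finset.mem_filter, not_and] at ha hb haq ⊢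
    refine ⟨hb.1, (le_total (f a) (f b)).elim (fun hab => hp a ha.1 b hb.1 hab ha.2) fun hba => ?_⟩
    exact absurd (hq b hb.1 a ha.1 hba hb.2) (haq ha.1)

theorem inversion_iff_of_permCode_eq {N : ℕ} {σ σ' : Equiv.Perm (Fin N)}
    (h : permCode σ = permCode σ') (i : Fin N) :
    ∀ j < i, σ.symm i < σ.symm j ↔ σ'.symm i < σ'.symm j := by
  induction i using WellFoundedLT.induction with
  | ind i ih =>
    have lt_iff (a : Fin N) (ha : a < i) (b : Fin N) (hb : b < i) :
        σ.symm a < σ.symm b ↔ σ'.symm a < σ'.symm b :=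
      lt_iff_lt_of_inversion_iff σ.symm.injective σ'.symm.injective (ih a ha b) (ih b hb a)
    have hcard := congrFun h i
    simp only [permCode, ← Finset.filter_filter] at hcard
    have heq := filter_eq_filter_of_card_eq (f := σ.symm) (fun a _ b _ hab ha => ha.trans_le hab)
      (fun a ha b hb hab hq => ?_) hcard
    · intro j hj
      simpa [hj] using Finset.ext_iff.1 heq j
    · simp only [Finset.mem_filter, Finset.mem_univ, true_and] at ha hb
      refine hq.trans_le ?_
      rwa [← not_lt, ← lt_iff b hb a ha, not_lt]

theorem permCode_injective {N : ℕ} :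
    Function.Injective (permCode : Equiv.Perm (Fin N) → Fin N → ℕ) := by
  intro σ σ' h
  have hlt (i j : Fin N) : σ.symm j < σ.symm i ↔ σ'.symm j < σ'.symm i :=
    lt_iff_lt_of_inversion_iff σ.symm.injective σ'.symm.injective
      (inversion_iff_of_permCode_eq h j i) (inversion_iff_of_permCode_eq h i j)
  exact Equiv.symm_bijective.1 (perm_eq_of_lt_iff_lt hlt)

theorem exists_permCode_eq {N : ℕ} {c : Fin N → ℕ} (hc : ∀ i, c i ≤ i) :
    ∃ σ : Equiv.Perm (Fin N), permCode σ = c := by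
  have hbij : Function.Bijective (fun (σ : Equiv.Perm (Fin N)) (i : Fin N) =>
      (⟨permCode σ i, Nat.lt_succ_of_le (permCode_le σ i)⟩ : Fin ((i : ℕ) + 1))) := by
    refine (Fintype.bijective_iff_injective_and_card _).2 ⟨fun σ σ' h => ?_, ?_⟩
    · exact permCode_injective (funext fun i => by simpa using congrFun h i)
    · simp only [Fintype.card_perm, Fintype.card_pi, Fintype.card_fin]
      rw [Fin.prod_univ_eq_prod_range (fun i => i + 1), Finset.prod_range_add_one_eq_factorial]
  obtain ⟨σ, hσ⟩ := hbij.2 fun i => ⟨c i, Nat.lt_succ_of_le (hc i)⟩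
  exact ⟨σ, funext fun i => by simpa using congrFun hσ i⟩

theorem map_range_sub_reverse {n k : ℕ} (hk : k ≤ n) :
    ((List.range k).map (n - ·)).reverse = List.Ico (n + 1 - k) (n + 1) := by
  induction k with
  | zero => simp
  | succ k ih =>
    rw [List.range_succ, List.map_append, List.reverse_append, ih (by omega),
      List.Ico.eq_cons (show n + 1 - (k + 1) < n + 1 by omega),
      show n + 1 - (k + 1) + 1 = n + 1 - k by omega]
    simp

theorem codeWord_eq_reverse_flatMap {c : ℕ → ℕ} {n : ℕ} (hc : ∀ i < n, c i ≤ i) :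
    codeWord c n = ((List.range n).flatMap fun i => (List.range (c i)).map (i - ·)).reverse := by
  induction n with
  | zero => rfl
  | succ n ih =>
    rw [codeWord, ih fun i hi => hc i (by omega), List.range_succ, List.flatMap_append,
      List.flatMap_singleton, List.reverse_append, map_range_sub_reverse (hc n n.lt_succ_self)]

theorem codeWord_permCode {N : ℕ} {σ : Equiv.Perm (Fin N)} {c : ℕ → ℕ}
    (h : ∀ i : Fin N, c i = permCode σ i) : codeWord c N = (permWord σ).reverse := by
  rw [codeWord_eq_reverse_flatMap fun i hi => h ⟨i, hi⟩ ▸ permCode_le σ _, permWord,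
    ← List.map_coe_finRange_eq_range, List.flatMap_map]
  simp only [h]

theorem exists_permWord_eq_reverse_codeWord {N : ℕ} (σ : Equiv.Perm (Fin N)) :
    ∃ c : ℕ → ℕ, (∀ i, c i ≤ i) ∧ (∀ i : Fin N, c i = permCode σ i) ∧
      permWord σ = (codeWord c N).reverse := by
  refine ⟨fun i => if h : i < N then permCode σ ⟨i, h⟩ else 0, fun i => ?_, fun i => by simp, ?_⟩
  · dsimp only
    split_ifs with h
    · exact permCode_le σ ⟨i, h⟩
    · exact Nat.zero_le i
  · rw [codeWord_permCode (σ := σ) fun i => by simp, List.reverse_reverse]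

theorem reducedWord_permWord {N : ℕ} (σ : Equiv.Perm (Fin N)) : ReducedWord (permWord σ) := by
  obtain ⟨c, -, -, e⟩ := exists_permWord_eq_reverse_codeWord σ
  exact e ▸ (reducedWord_codeWord c N).reverse

theorem perm_eq_of_traceEq_permWord {N : ℕ} {σ σ' : Equiv.Perm (Fin N)}
    (h : TraceEq (permWord σ) (permWord σ')) : σ = σ' := by
  obtain ⟨c, hc, hcσ, e⟩ := exists_permWord_eq_reverse_codeWord σ
  obtain ⟨c', hc', hcσ', e'⟩ := exists_permWord_eq_reverse_codeWord σ'
  rw [e, e'] at h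
  have hcc := eq_of_traceEq_codeWord hc hc' (n := N) (by simpa using h.reverse)
  exact permCode_injective (funext fun i => by rw [← hcσ, ← hcσ', hcc i i.2])

theorem ReducedWord.exists_perm {N : ℕ} {w : List ℕ} (h : ReducedWord w)
    (hw : ∀ i ∈ w, 1 ≤ i ∧ i < N) : ∃ σ : Equiv.Perm (Fin N), TraceEq w (permWord σ) := by
  obtain ⟨c, hc, ht⟩ := h.reverse.exists_codeWord (n := N) (by simpa using hw)
  obtain ⟨σ, hσ⟩ := exists_permCode_eq (c := fun i : Fin N => c i) fun i => hc i
  rw [codeWord_permCode (σ := σ) fun i => (congrFun hσ i).symm] at ht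
  exact ⟨σ, by simpa using ht.reverse⟩

/-! ## The regular representation -/

/-- A family of elements of a `K`-algebra, indexed by `ℕ`, that satisfies the relations of the Okada
algebra with parameters `x` and `y`. -/
structure IsOkadaFamily {K A : Type*} [CommSemiring K] [Semiring A] [Algebra K A] (x y : ℕ → K)
    (T : ℕ → A) : Prop where
  mul_self (i : ℕ) : T i * T i = x i • T i
  commute (i j : ℕ) (h : i + 2 ≤ j) : Commute (T i) (T j)
  mul_mul_succ (i : ℕ) : T (i + 1) * T i * T (i + 1) = y i • T (i + 1)

/-- The product `T m * T (m + 1) * ⋯ * T (n - 1)`. -/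
def runProd {M : Type*} [Monoid M] (T : ℕ → M) (m n : ℕ) : M := ((List.Ico m n).map T).prod

theorem runProd_self {M : Type*} [Monoid M] (T : ℕ → M) (m : ℕ) : runProd T m m = 1 := by
  simp [runProd]

theorem runProd_eq_mul {M : Type*} [Monoid M] (T : ℕ → M) {m n : ℕ} (h : m < n) :
    runProd T m n = T m * runProd T (m + 1) n := by
  rw [runProd, List.Ico.eq_cons h, List.map_cons, List.prod_cons, runProd]

theorem runProd_mul_runProd {M : Type*} [Monoid M] (T : ℕ → M) {k m n : ℕ} (hkm : k ≤ m)
    (hmn : m ≤ n) : runProd T k m * runProd T m n = runProd T k n := by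
  rw [runProd, runProd, ← List.prod_append, ← List.map_append,
    List.Ico.append_consecutive hkm hmn, runProd]

theorem commute_runProd {M : Type*} [Monoid M] {T : ℕ → M} {a : M} {m n : ℕ}
    (h : ∀ i, m ≤ i → i < n → Commute a (T i)) : Commute a (runProd T m n) := by
  refine Commute.list_prod_right _ _ fun b hb => ?_
  obtain ⟨i, hi, rfl⟩ := List.mem_map.1 hb
  exact h i (List.Ico.mem.1 hi).1 (List.Ico.mem.1 hi).2

namespace IsOkadaFamily

variable {K A : Type*} [CommSemiring K] [Semiring A] [Algebra K A] {x y : ℕ → K} {T : ℕ → A}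

theorem mul_runProd_self (hT : IsOkadaFamily x y T) {i n : ℕ} (hin : i < n) :
    T i * runProd T i n = x i • runProd T i n := by
  rw [runProd_eq_mul T hin, ← mul_assoc, hT.mul_self, smul_mul_assoc]

theorem mul_runProd_of_lt (hT : IsOkadaFamily x y T) {i m n : ℕ} (hmi : m < i) (hin : i < n) :
    T i * runProd T m n = y (i - 1) • (runProd T i n * runProd T m (i - 1)) := by
  obtain ⟨i, rfl⟩ : ∃ j, i = j + 1 := ⟨i - 1, by omega⟩
  have hcomm : Commute (T (i + 1)) (runProd T m i) :=
    commute_runProd fun j _ hj => (hT.commute j (i + 1) (by omega)).symm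
  have hrun : Commute (runProd T m i) (runProd T (i + 1) n) :=
    commute_runProd fun k hk _ =>
      (commute_runProd fun j _ hj => (hT.commute j k (by omega)).symm).symm
  calc T (i + 1) * runProd T m n
      = T (i + 1) * (runProd T m i * (T i * (T (i + 1) * runProd T (i + 2) n))) := by
        rw [← runProd_eq_mul T hin, ← runProd_eq_mul T (show i < n by omega),
          runProd_mul_runProd T (by omega) (by omega)]
    _ = runProd T m i * (T (i + 1) * T i * T (i + 1) * runProd T (i + 2) n) := by
        rw [← mul_assoc, hcomm.eq]
        simp only [mul_assoc]
    _ = y i • (runProd T (i + 1) n * runProd T m i) := by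
        rw [hT.mul_mul_succ, smul_mul_assoc, ← runProd_eq_mul T hin, mul_smul_comm, hrun.eq]

end IsOkadaFamily

section ExtendOp

variable {K : Type*} [CommSemiring K] {B : Type*} (x y : ℕ → K) (T : ℕ → Module.End K (B →₀ K))

/-- The inclusion of `B →₀ K` as the block with index `m`. -/
noncomputable def consBlock (K : Type*) [CommSemiring K] {B : Type*} (m : ℕ) :
    (B →₀ K) →ₗ[K] (ℕ × B →₀ K) := Finsupp.lmapDomain K K (Prod.mk m)

/-- The restriction of `extendOp x y T i` to the block with index `m`. Think of the block with index
`m` as the multiples of `E_m ⋯ E_n` by elements of a smaller Okada algebra, on which the `E_j` act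
by `T j`; the formula is what the relations give for the left multiplication by `E_i`. -/
noncomputable def extendBlock (i m : ℕ) : (B →₀ K) →ₗ[K] (ℕ × B →₀ K) :=
  if i + 1 < m then consBlock K m ∘ₗ T i
  else if i + 1 = m then consBlock K i
  else if i = m then x i • consBlock K i
  else y (i - 1) • consBlock K i ∘ₗ runProd T m (i - 1)

/-- The extension of a family of operators on `B →₀ K` to operators on the direct sum of copies of
`B →₀ K` indexed by `ℕ`. It is the induction step in the construction of the regular representation
of the Okada algebra. -/
noncomputable def extendOp (i : ℕ) : Module.End K (ℕ × B →₀ K) :=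
  Finsupp.linearCombination K fun p => extendBlock x y T i p.1 (Finsupp.single p.2 1)

theorem extendOp_consBlock (i m : ℕ) (v : B →₀ K) :
    extendOp x y T i (consBlock K m v) = extendBlock x y T i m v := by
  suffices extendOp x y T i ∘ₗ consBlock K m = extendBlock x y T i m from LinearMap.congr_fun this v
  ext u
  simp [extendOp, consBlock]

variable {T}

theorem end_ext_consBlock {f g : Module.End K (ℕ × B →₀ K)}
    (h : ∀ m v, f (consBlock K m v) = g (consBlock K m v)) : f = g := by
  refine Finsupp.lhom_ext fun p k => ?_
  simpa [consBlock] using h p.1 (Finsupp.single p.2 k)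

theorem extendOp_of_succ_lt {i m : ℕ} (h : i + 1 < m) (v : B →₀ K) :
    extendOp x y T i (consBlock K m v) = consBlock K m (T i v) := by
  rw [extendOp_consBlock, extendBlock, if_pos h, LinearMap.comp_apply]

theorem extendOp_succ (i : ℕ) (v : B →₀ K) :
    extendOp x y T i (consBlock K (i + 1) v) = consBlock K i v := by
  rw [extendOp_consBlock, extendBlock, if_neg (lt_irrefl _), if_pos rfl]

theorem extendOp_self (i : ℕ) (v : B →₀ K) :
    extendOp x y T i (consBlock K i v) = x i • consBlock K i v := by
  rw [extendOp_consBlock, extendBlock, if_neg (by omega), if_neg (by omega), if_pos rfl,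
    LinearMap.smul_apply]

theorem extendOp_of_lt {i m : ℕ} (h : m < i) (v : B →₀ K) :
    extendOp x y T i (consBlock K m v) =
      y (i - 1) • consBlock K i (runProd T m (i - 1) v) := by
  rw [extendOp_consBlock, extendBlock, if_neg (by omega), if_neg (by omega), if_neg (by omega)]
  rfl

variable {x y}

theorem extendOp_commute (hT : IsOkadaFamily x y T) {i j : ℕ} (hij : i + 2 ≤ j) :
    Commute (extendOp x y T i) (extendOp x y T j) := by
  refine end_ext_consBlock fun m v => ?_
  simp only [Module.End.mul_apply]
  rcases lt_trichotomy m j with hmj | rfl | hmj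
  · rw [extendOp_of_lt x y hmj, map_smul, extendOp_of_succ_lt x y (show i + 1 < j by omega),
      ← Module.End.mul_apply]
    rcases lt_trichotomy m i with hmi | rfl | hmi
    · rw [extendOp_of_lt x y hmi, map_smul, extendOp_of_lt x y (show i < j by omega),
        hT.mul_runProd_of_lt hmi (by omega), ← Module.End.mul_apply, LinearMap.smul_apply, map_smul,
        smul_comm]
    · rw [extendOp_self, map_smul, extendOp_of_lt x y hmj, hT.mul_runProd_self (by omega),
        LinearMap.smul_apply, map_smul, smul_comm]
    · rcases (Nat.succ_le_of_lt hmi).eq_or_lt with rfl | hmi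
      · rw [extendOp_succ, extendOp_of_lt x y (show i < j by omega),
          runProd_eq_mul T (show i < j - 1 by omega)]
      · have hcomm : Commute (T i) (runProd T m (j - 1)) :=
          commute_runProd fun k hk _ => hT.commute i k (by omega)
        rw [extendOp_of_succ_lt x y hmi, extendOp_of_lt x y hmj, hcomm.eq, Module.End.mul_apply]
  · rw [extendOp_self, map_smul, extendOp_of_succ_lt x y (by omega), extendOp_self]
  · rw [extendOp_of_succ_lt x y (show i + 1 < m by omega)]
    rcases (Nat.succ_le_of_lt hmj).eq_or_lt with rfl | hmj
    · rw [extendOp_succ, extendOp_succ, extendOp_of_succ_lt x y (by omega)]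
    · rw [extendOp_of_succ_lt x y hmj, extendOp_of_succ_lt x y hmj,
        extendOp_of_succ_lt x y (by omega), ← Module.End.mul_apply, (hT.commute i j hij).eq,
        Module.End.mul_apply]

theorem isOkadaFamily_extendOp (hT : IsOkadaFamily x y T) : IsOkadaFamily x y (extendOp x y T) where
  commute i j hij := extendOp_commute hT hij
  mul_self i := end_ext_consBlock fun m v => by
    simp only [Module.End.mul_apply, LinearMap.smul_apply]
    rcases lt_trichotomy m i with hmi | rfl | hmi
    · rw [extendOp_of_lt x y hmi, map_smul, extendOp_self, smul_comm]
    · rw [extendOp_self, map_smul, extendOp_self]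
    · rcases (Nat.succ_le_of_lt hmi).eq_or_lt with rfl | hmi
      · rw [extendOp_succ, extendOp_self]
      · rw [extendOp_of_succ_lt x y hmi, extendOp_of_succ_lt x y hmi, ← Module.End.mul_apply,
          hT.mul_self, LinearMap.smul_apply, map_smul]
  mul_mul_succ i := end_ext_consBlock fun m v => by
    have hrun (v : B →₀ K) : extendOp x y T (i + 1) (extendOp x y T i (consBlock K (i + 1) v)) =
        y i • consBlock K (i + 1) v := by
      rw [extendOp_succ, extendOp_of_lt x y (Nat.lt_add_one i), Nat.add_sub_cancel, runProd_self]
      rfl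
    simp only [Module.End.mul_apply, LinearMap.smul_apply]
    rcases lt_trichotomy m (i + 1) with hmi | rfl | hmi
    · rw [extendOp_of_lt x y hmi, map_smul, map_smul, hrun, smul_comm]
    · rw [extendOp_self, map_smul, map_smul, hrun, smul_comm]
    · rcases (Nat.succ_le_of_lt hmi).eq_or_lt with rfl | hmi
      · rw [extendOp_succ, hrun]
      · rw [extendOp_of_succ_lt x y hmi, extendOp_of_succ_lt x y (by omega),
          extendOp_of_succ_lt x y hmi, ← map_smul, ← LinearMap.smul_apply, ← hT.mul_mul_succ]
        rfl

end ExtendOp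

/-- The basis of the regular representation: `(m_n, (…, (m_2, (m_1, ()))))` stands for the normal
form `E_{m_n} ⋯ E_{n-1} · ⋯ · E_{m_2} ⋯ E_1 · E_{m_1} ⋯ E_0`, see `OkadaCode.word`. -/
@[reducible] def OkadaCode : ℕ → Type
  | 0 => Unit
  | n + 1 => ℕ × OkadaCode n

namespace OkadaCode

/-- The word of a normal form. -/
def word : {n : ℕ} → OkadaCode n → List ℕ
  | 0, _ => []
  | n + 1, (m, u) => List.Ico m (n + 1) ++ word u

/-- The entries of a code are in the range in which they occur in normal forms: `1 ≤ m_i ≤ i`. -/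
def Valid : {n : ℕ} → OkadaCode n → Prop
  | 0, _ => True
  | n + 1, (m, u) => (1 ≤ m ∧ m ≤ n + 1) ∧ Valid u

/-- The code with block lengths `c 0, …, c (n - 1)`. -/
def ofLengths (c : ℕ → ℕ) : (n : ℕ) → OkadaCode n
  | 0 => ()
  | n + 1 => (n + 1 - c n, ofLengths c n)

theorem word_ofLengths (c : ℕ → ℕ) (n : ℕ) : (ofLengths c n).word = codeWord c n := by
  induction n with
  | zero => rfl
  | succ n ih => rw [codeWord, ← ih, ofLengths, word]

theorem valid_ofLengths {c : ℕ → ℕ} (hc : ∀ i, c i ≤ i) (n : ℕ) : (ofLengths c n).Valid := by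
  induction n with
  | zero => trivial
  | succ n ih =>
    have := hc n
    exact ⟨by omega, ih⟩

theorem mem_word {n : ℕ} {u : OkadaCode n} (hu : u.Valid) {a : ℕ} (ha : a ∈ u.word) :
    1 ≤ a ∧ a < n := by
  induction n with
  | zero => simp [word] at ha
  | succ n ih =>
    obtain ⟨m, u⟩ := u
    rcases List.mem_append.1 ha with ha | ha
    · have := List.Ico.mem.1 ha
      exact ⟨hu.1.1.trans this.1, this.2⟩
    · have := ih hu.2 ha
      omega

/-- The code of the empty word. -/
def empty (n : ℕ) : OkadaCode n := ofLengths 0 n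

theorem valid_empty (n : ℕ) : (empty n).Valid := valid_ofLengths (fun i => i.zero_le) n

theorem word_empty (n : ℕ) : (empty n).word = [] := by
  induction n with
  | zero => rfl
  | succ n ih =>
    rw [empty, ofLengths, word, ← empty, ih]
    simp

end OkadaCode

section CodeOp

variable {K : Type*} [CommSemiring K] (x y : ℕ → K)

/-- The operators of the regular representation. -/
noncomputable def codeOp : (n : ℕ) → ℕ → Module.End K (OkadaCode n →₀ K)
  | 0 => 0
  | n + 1 => extendOp x y (codeOp n)

theorem isOkadaFamily_codeOp (n : ℕ) : IsOkadaFamily x y (codeOp x y n) := by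
  induction n with
  | zero => exact ⟨by simp [codeOp], by simp [codeOp], by simp [codeOp]⟩
  | succ n ih => exact isOkadaFamily_extendOp ih

/-- The vector `f` is what a word `w` in the generators may be in the regular representation: a
multiple of a normal form that is not longer than `w`, and that is equivalent to `w` if it has the
same length. -/
def Represents {n : ℕ} (w : List ℕ) (f : OkadaCode n →₀ K) : Prop :=
  ∃ u k, f = Finsupp.single u k ∧ u.Valid ∧ u.word.length ≤ w.length ∧
    (u.word.length = w.length → TraceEq u.word w)

theorem represents_word {n : ℕ} {u : OkadaCode n} (hu : u.Valid) :
    Represents u.word (Finsupp.single u (1 : K)) :=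
  ⟨u, 1, rfl, hu, le_rfl, fun _ => .refl _⟩

namespace Represents

variable {x y} {n : ℕ} {w : List ℕ}

theorem smul {f : OkadaCode n →₀ K} (h : Represents w f) (k : K) : Represents w (k • f) := by
  obtain ⟨u, l, rfl, h⟩ := h
  exact ⟨u, k * l, by rw [Finsupp.smul_single, smul_eq_mul], h⟩

theorem cons_of_forall {T : ℕ → Module.End K (OkadaCode n →₀ K)} {i : ℕ}
    (hT : ∀ u : OkadaCode n, u.Valid → Represents (i :: u.word) (T i (Finsupp.single u 1)))
    {f : OkadaCode n →₀ K} (h : Represents w f) : Represents (i :: w) (T i f) := by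
  obtain ⟨u, k, rfl, hu, hlen, ht⟩ := h
  obtain ⟨u', k', he, hu', hlen', ht'⟩ := hT u hu
  rw [List.length_cons] at hlen' ht'
  refine ⟨u', k * k', ?_, hu', by rw [List.length_cons]; omega, fun h => ?_⟩
  · rw [← mul_one k, ← smul_eq_mul, ← Finsupp.smul_single, map_smul, he, Finsupp.smul_single,
      smul_eq_mul, smul_eq_mul, mul_one]
  · rw [List.length_cons] at h
    exact (ht' (by omega)).trans ((ht (by omega)).append_left [i])

theorem append_of_forall {T : ℕ → Module.End K (OkadaCode n →₀ K)} {v : List ℕ}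
    (hT : ∀ i ∈ v, ∀ u : OkadaCode n, u.Valid →
      Represents (i :: u.word) (T i (Finsupp.single u 1)))
    {f : OkadaCode n →₀ K} (h : Represents w f) : Represents (v ++ w) ((v.map T).prod f) := by
  induction v with
  | nil => exact h
  | cons i v ih =>
    rw [List.map_cons, List.prod_cons, Module.End.mul_apply, List.cons_append]
    exact (ih fun j hj => hT j (List.mem_cons_of_mem i hj)).cons_of_forall (hT i List.mem_cons_self)

theorem consBlock_of_lt {i m : ℕ} (hm : 1 ≤ m ∧ m ≤ n + 1) (him : i + 1 < m) {f : OkadaCode n →₀ K}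
    (h : Represents (i :: w) f) :
    Represents (n := n + 1) (i :: (List.Ico m (n + 1) ++ w)) (consBlock K m f) := by
  obtain ⟨u, k, rfl, hu, hlen, ht⟩ := h
  have hcomm : TraceEq (List.Ico m (n + 1) ++ [i]) ([i] ++ List.Ico m (n + 1)) :=
    .append_comm fun a ha b hb => by
      have := List.Ico.mem.1 ha
      have := List.mem_singleton.1 hb
      omega
  refine ⟨(m, u), k, Finsupp.mapDomain_single, ⟨hm, hu⟩, ?_, fun hlen' => ?_⟩
  · simpa [OkadaCode.word, add_assoc] using hlen
  · refine ((ht ?_).append_left _).trans (by simpa using hcomm.append_right w)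
    simpa [OkadaCode.word, add_assoc] using hlen'

theorem consBlock_of_length_lt {i m : ℕ} (hi : 1 ≤ i ∧ i ≤ n) (hmi : m < i) {v : List ℕ}
    {f : OkadaCode n →₀ K} (h : Represents (List.Ico m (i - 1) ++ v) f) :
    Represents (n := n + 1) (i :: (List.Ico m (n + 1) ++ v)) (consBlock K i f) := by
  obtain ⟨u, k, rfl, hu, hlen, -⟩ := h
  have hlt : (OkadaCode.word (n := n + 1) (i, u)).length <
      (i :: (List.Ico m (n + 1) ++ v)).length := by
    simp only [List.length_append, List.Ico.length, OkadaCode.word, List.length_cons] at hlen ⊢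
    omega
  exact ⟨(i, u), k, Finsupp.mapDomain_single, ⟨⟨hi.1, by omega⟩, hu⟩, hlt.le,
    fun h => absurd h hlt.ne⟩

end Represents

theorem represents_codeOp {n i : ℕ} (hi : 1 ≤ i ∧ i < n) {u : OkadaCode n} (hu : u.Valid) :
    Represents (i :: u.word) (codeOp x y n i (Finsupp.single u 1)) := by
  induction n generalizing i with
  | zero => omega
  | succ n ih =>
    obtain ⟨m, u⟩ := u
    have hmu := hu
    obtain ⟨hm, hu⟩ := hu
    have hsingle : (Finsupp.single (m, u) 1 : ℕ × OkadaCode n →₀ K) =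
        consBlock K m (Finsupp.single u 1) := Finsupp.mapDomain_single.symm
    rw [codeOp, hsingle, OkadaCode.word]
    rcases lt_trichotomy m i with hmi | rfl | hmi
    · rw [extendOp_of_lt x y hmi]
      refine (Represents.consBlock_of_length_lt (by omega) hmi ?_).smul _
      refine (represents_word hu).append_of_forall fun j hj u' hu' => ih ?_ hu'
      have := List.Ico.mem.1 hj
      omega
    · rw [extendOp_self, List.Ico.eq_cons hi.2]
      refine Represents.smul ⟨(m, u), 1, hsingle.symm, hmu, ?_, fun h => absurd h ?_⟩ _ <;>
      · rw [OkadaCode.word, List.Ico.eq_cons hi.2]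
        simp
    · rcases (Nat.succ_le_of_lt hmi).eq_or_lt with rfl | hmi
      · rw [extendOp_succ, ← List.cons_append, ← List.Ico.eq_cons hi.2]
        exact ⟨(i, u), 1, Finsupp.mapDomain_single, ⟨⟨hi.1, hi.2.le⟩, hu⟩, le_rfl, fun _ => .refl _⟩
      · rw [extendOp_of_succ_lt x y hmi]
        exact (ih (by omega) hu).consBlock_of_lt hm hmi

theorem represents_codeOp_prod {n : ℕ} {w : List ℕ} (hw : ∀ i ∈ w, 1 ≤ i ∧ i < n) :
    Represents w ((w.map (codeOp x y n)).prod (Finsupp.single (OkadaCode.empty n) 1)) := by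
  simpa [OkadaCode.word_empty] using (represents_word (OkadaCode.valid_empty n)).append_of_forall
    fun i hi u hu => represents_codeOp x y (hw i hi) hu

theorem prod_extendOp_consBlock_of_lt {B : Type*} {T : ℕ → Module.End K (B →₀ K)} {m : ℕ}
    {w : List ℕ} (hw : ∀ i ∈ w, i + 1 < m) (v : B →₀ K) :
    (w.map (extendOp x y T)).prod (consBlock K m v) = consBlock K m ((w.map T).prod v) := by
  induction w with
  | nil => rfl
  | cons i w ih =>
    simp only [List.map_cons, List.prod_cons, Module.End.mul_apply]
    rw [ih fun j hj => hw j (List.mem_cons_of_mem i hj),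
      extendOp_of_succ_lt x y (hw i List.mem_cons_self)]

theorem runProd_extendOp_consBlock {B : Type*} {T : ℕ → Module.End K (B →₀ K)} {m n : ℕ}
    (h : m ≤ n) (v : B →₀ K) :
    runProd (extendOp x y T) m n (consBlock K n v) = consBlock K m v := by
  induction h using Nat.decreasingInduction with
  | self => rw [runProd_self, Module.End.one_apply]
  | of_succ m hm ih => rw [runProd_eq_mul _ hm, Module.End.mul_apply, ih, extendOp_succ]

theorem codeOp_word {n : ℕ} {u : OkadaCode n} (hu : u.Valid) :
    (u.word.map (codeOp x y n)).prod (Finsupp.single (OkadaCode.empty n) 1) =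
      Finsupp.single u 1 := by
  induction n with
  | zero => rfl
  | succ n ih =>
    obtain ⟨m, u⟩ := u
    have hempty : (Finsupp.single (OkadaCode.empty (n + 1)) 1 : OkadaCode (n + 1) →₀ K) =
        consBlock K (n + 1) (Finsupp.single (OkadaCode.empty n) 1) :=
      Finsupp.mapDomain_single.symm
    have hlt : ∀ i ∈ u.word, i + 1 < n + 1 := fun i hi =>
      Nat.succ_lt_succ (OkadaCode.mem_word hu.2 hi).2
    rw [OkadaCode.word, List.map_append, List.prod_append, Module.End.mul_apply, hempty, codeOp,
      prod_extendOp_consBlock_of_lt x y hlt, ih hu.2]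
    exact (runProd_extendOp_consBlock x y hu.1.2 _).trans Finsupp.mapDomain_single

variable [Nontrivial K]

theorem ReducedWord.traceEq_of_codeOp_prod_eq {n : ℕ} {w w' : List ℕ} (hred : ReducedWord w)
    (hw : ∀ i ∈ w, 1 ≤ i ∧ i < n) (hw' : ∀ i ∈ w', 1 ≤ i ∧ i < n) (hlen : w.length = w'.length)
    (h : (w.map (codeOp x y n)).prod = (w'.map (codeOp x y n)).prod) : TraceEq w w' := by
  obtain ⟨c, hc, ht⟩ := hred.exists_codeWord hw
  rw [← OkadaCode.word_ofLengths] at ht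
  obtain ⟨u, k, he, -, -, ht'⟩ := represents_codeOp_prod x y hw'
  rw [← h, ht.prod_map_eq (isOkadaFamily_codeOp x y n).commute,
    codeOp_word x y (OkadaCode.valid_ofLengths hc n), Finsupp.single_eq_single_iff] at he
  rcases he with ⟨rfl, -⟩ | ⟨h10, -⟩
  · exact ht.trans (ht' (by rw [← hlen, ht.perm.length_eq]))
  · exact absurd h10 one_ne_zero

end CodeOp

section OkadaWord

variable {K : Type*} [Field K] {N : ℕ} (X : Fin (N - 1) → K) (Y : Fin (N - 2) → K)

/-- The parameters `x_i`, extended by `0`. -/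
def extendX (i : ℕ) : K := if h : 1 ≤ i ∧ i < N then X ⟨i - 1, by omega⟩ else 0

/-- The parameters `y_i`, extended by `0`. -/
def extendY (i : ℕ) : K := if h : 1 ≤ i ∧ i + 1 < N then Y ⟨i - 1, by omega⟩ else 0

theorem extendX_succ (i : Fin (N - 1)) : extendX X (i + 1) = X i := by
  rw [extendX, dif_pos (by omega)]
  rfl

theorem extendY_succ (i : Fin (N - 2)) : extendY Y (i + 1) = Y i := by
  rw [extendY, dif_pos (by omega)]
  rfl

/-- The algebra homomorphism out of the Okada algebra given by elements that satisfy its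
relations. -/
noncomputable def okadaLift {A : Type*} [Semiring A] [Algebra K A] {T : ℕ → A}
    (hT : IsOkadaFamily (extendX X) (extendY Y) T) : OkadaAlgebra N X Y →ₐ[K] A :=
  RingQuot.liftAlgHom K ⟨FreeAlgebra.lift K fun i : Fin (N - 1) => T (i + 1), by
    rintro _ _ (i | ⟨i, j, h⟩ | ⟨i, j, k, hi, hj⟩)
    · simp only [map_mul, map_smul, FreeAlgebra.lift_ι_apply]
      rw [hT.mul_self, extendX_succ]
    · simp only [map_mul, FreeAlgebra.lift_ι_apply]
      exact hT.commute _ _ (by omega)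
    · simp only [map_mul, map_smul, FreeAlgebra.lift_ι_apply, hi, hj]
      rw [hT.mul_mul_succ, extendY_succ]⟩

theorem okadaLift_okadaGen {A : Type*} [Semiring A] [Algebra K A] {T : ℕ → A}
    (hT : IsOkadaFamily (extendX X) (extendY Y) T) {i : ℕ} (hi : 1 ≤ i ∧ i < N) :
    okadaLift X Y hT (okadaGen N X Y i) = T i := by
  rw [okadaGen, dif_pos hi, okadaLift, RingQuot.liftAlgHom_mkAlgHom_apply,
    FreeAlgebra.lift_ι_apply, Nat.sub_add_cancel hi.1]

/-- The product of the generators along a word. -/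
noncomputable def okadaWord (w : List ℕ) : OkadaAlgebra N X Y := (w.map (okadaGen N X Y)).prod

theorem okadaLift_okadaWord {A : Type*} [Semiring A] [Algebra K A] {T : ℕ → A}
    (hT : IsOkadaFamily (extendX X) (extendY Y) T) {w : List ℕ} (hw : ∀ i ∈ w, 1 ≤ i ∧ i < N) :
    okadaLift X Y hT (okadaWord X Y w) = (w.map T).prod := by
  rw [okadaWord, map_list_prod, List.map_map]
  exact congrArg List.prod (List.map_congr_left fun i hi => okadaLift_okadaGen X Y hT (hw i hi))

theorem okadaWord_append (u v : List ℕ) :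
    okadaWord X Y (u ++ v) = okadaWord X Y u * okadaWord X Y v := by simp [okadaWord]

theorem okadaPerm_eq_okadaWord (σ : Equiv.Perm (Fin N)) :
    okadaPerm N X Y σ = okadaWord X Y (permWord σ) := rfl

theorem okadaGen_commute {i j : ℕ} (h : i + 2 ≤ j) :
    Commute (okadaGen N X Y i) (okadaGen N X Y j) := by
  rw [okadaGen, okadaGen]
  split_ifs with hi hj
  · rw [Commute, SemiconjBy, ← map_mul, ← map_mul]
    exact RingQuot.mkAlgHom_rel K (OkadaRel.comm _ _ (by simp only; omega))
  · exact Commute.one_right _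
  · exact Commute.one_left _
  · exact Commute.one_left _

theorem TraceEq.okadaWord_eq {u v : List ℕ} (h : TraceEq u v) :
    okadaWord X Y u = okadaWord X Y v :=
  h.prod_map_eq fun _ _ => okadaGen_commute X Y

theorem ReducedWord.traceEq_of_okadaWord_eq {w w' : List ℕ} (hred : ReducedWord w)
    (hw : ∀ i ∈ w, 1 ≤ i ∧ i < N) (hw' : ∀ i ∈ w', 1 ≤ i ∧ i < N) (hlen : w.length = w'.length)
    (h : okadaWord X Y w = okadaWord X Y w') : TraceEq w w' := by
  refine hred.traceEq_of_codeOp_prod_eq (extendX X) (extendY Y) hw hw' hlen ?_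
  have hT := isOkadaFamily_codeOp (extendX X) (extendY Y) N
  rw [← okadaLift_okadaWord X Y hT hw, ← okadaLift_okadaWord X Y hT hw', h]

end OkadaWord

/-! ## Counting functions of Fibonacci sets -/

/-- The counting function of a set `C`: the number of its elements that are at least `x`. Both
the conditions on a Fibonacci set and the dominance order are read off from it. -/
def countGe (C : Finset ℕ) (x : ℕ) : ℕ := (C.filter (x ≤ ·)).card

section CountGe

variable {C : Finset ℕ} {x : ℕ}

theorem countGe_le_card : countGe C x ≤ C.card := Finset.card_filter_le _ _

theorem countGe_eq_card_of_forall_le (h : ∀ y ∈ C, x ≤ y) : countGe C x = C.card := by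
  rw [countGe, Finset.filter_true_of_mem h]

theorem countGe_eq_zero_of_forall_lt (h : ∀ y ∈ C, y < x) : countGe C x = 0 := by
  rw [countGe, Finset.filter_false_of_mem fun y hy => (h y hy).not_ge, Finset.card_empty]

theorem countGe_eq_countGe_succ (C : Finset ℕ) (x : ℕ) :
    countGe C x = countGe C (x + 1) + if x ∈ C then 1 else 0 := by
  have disjointUnion : C.filter (x ≤ ·) = C.filter (x + 1 ≤ ·) ∪ C.filter (· = x) := by
    rw [← Finset.filter_or]
    exact Finset.filter_congr fun y _ => by omega
  rw [countGe, disjointUnion, Finset.card_union_of_disjoint, Finset.filter_eq', countGe]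
  · split_ifs <;> rfl
  · exact Finset.disjoint_filter.2 fun y _ _ => by omega

theorem card_filter_le_add_countGe (C : Finset ℕ) (x : ℕ) :
    (C.filter (· ≤ x)).card + countGe C (x + 1) = C.card := by
  rw [countGe, ← Finset.card_filter_add_card_filter_not (s := C) (· ≤ x)]
  simp only [not_le, Nat.lt_iff_add_one_le]

theorem countGe_insert {a : ℕ} (ha : a ∉ C) :
    countGe (insert a C) x = countGe C x + if x ≤ a then 1 else 0 := by
  rw [countGe, Finset.filter_insert]
  split_ifs
  · exact Finset.card_insert_of_notMem fun h => ha (Finset.mem_filter.1 h).1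
  · rfl

theorem countGe_filter_eq_succ {N : ℕ} {f : ℕ → ℕ} (hzero : ∀ y, N < y → f y = 0)
    (hstep : ∀ y, f y = f (y + 1) ∨ f y = f (y + 1) + 1) (hx : 1 ≤ x) :
    countGe ((Finset.Icc 1 N).filter fun y => f y = f (y + 1) + 1) x = f x := by
  obtain ⟨k, hk⟩ : ∃ k, N < x + k := ⟨N + 1, by omega⟩
  induction k generalizing x with
  | zero =>
    rw [hzero x hk, countGe_eq_zero_of_forall_lt]
    exact fun y hy => (Finset.mem_Icc.1 (Finset.mem_filter.1 hy).1).2.trans_lt hk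
  | succ k ih =>
    rw [countGe_eq_countGe_succ, ih (Nat.le_add_left 1 x) (by omega)]
    simp only [Finset.mem_filter, Finset.mem_Icc]
    have hzero_x := hzero x
    have hzero_succ := hzero (x + 1)
    rcases hstep x with h | h <;> split_ifs <;> omega

theorem le_getElem_iff_of_pairwise_gt {l : List ℕ} (hl : l.Pairwise (· > ·)) {i : ℕ}
    (hi : i < l.length) : x ≤ l[i] ↔ i < (l.filter (x ≤ ·)).length := by
  induction l generalizing i with
  | nil => simp at hi
  | cons a l ih =>
    rw [List.pairwise_cons] at hl
    by_cases hx : x ≤ a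
    · rw [List.filter_cons_of_pos (by simpa using hx)]
      cases i with
      | zero => simp [hx]
      | succ i =>
        rw [List.getElem_cons_succ, ih hl.2, List.length_cons]
        omega
    · have all_lt : ∀ b ∈ a :: l, ¬ x ≤ b := by
        simp only [List.forall_mem_cons]
        exact ⟨hx, fun b hb => by have := hl.1 b hb; omega⟩
      rw [List.filter_eq_nil_iff.2 (by simpa using all_lt), List.length_nil]
      exact iff_of_false (all_lt _ (List.getElem_mem hi)) (Nat.not_lt_zero i)

end CountGe

namespace FibonacciSet

variable {N : ℕ}

theorem one_le_of_mem {S : FibonacciSet N} {s : ℕ} (hs : s ∈ S.carrier) : 1 ≤ s :=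
  (Finset.mem_Icc.1 (S.subset_Icc hs)).1

theorem le_of_mem {S : FibonacciSet N} {s : ℕ} (hs : s ∈ S.carrier) : s ≤ N :=
  (Finset.mem_Icc.1 (S.subset_Icc hs)).2

theorem countGe_of_le_one (S : FibonacciSet N) {x : ℕ} (hx : x ≤ 1) :
    countGe S.carrier x = S.carrier.card :=
  countGe_eq_card_of_forall_le fun _ hs => hx.trans (one_le_of_mem hs)

theorem countGe_of_lt (S : FibonacciSet N) {x : ℕ} (hx : N < x) : countGe S.carrier x = 0 :=
  countGe_eq_zero_of_forall_lt fun _ hs => (le_of_mem hs).trans_lt hx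

theorem add_countGe_succ_modEq (S : FibonacciSet N) {s : ℕ} (hs : s ∈ S.carrier) :
    s + countGe S.carrier (s + 1) ≡ N [MOD 2] := by
  have helem := S.elem_parity s hs
  have hcard := S.card_parity
  have hadd := card_filter_le_add_countGe S.carrier s
  rw [Nat.ModEq] at *
  omega

/-- The Fibonacci set with carrier `C`, whose elements have the right parity with respect to the
number of larger elements (rather than their position from below). -/
def ofCountGe (C : Finset ℕ) (hC : C ⊆ Finset.Icc 1 N) (hcard : C.card ≡ N [MOD 2])
    (hparity : ∀ s ∈ C, s + countGe C (s + 1) ≡ N [MOD 2]) : FibonacciSet N where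
  carrier := C
  subset_Icc := hC
  card_parity := hcard
  elem_parity s hs := by
    have helem := hparity s hs
    have hadd := card_filter_le_add_countGe C s
    rw [Nat.ModEq] at *
    omega

theorem length_filter_desc (S : FibonacciSet N) (x : ℕ) :
    (S.desc.filter (x ≤ ·)).length = countGe S.carrier x := by
  have hnodup : (S.desc.filter (x ≤ ·)).Nodup := (S.carrier.sort_nodup _).filter _
  rw [countGe, ← List.toFinset_card_of_nodup hnodup, List.toFinset_filter, desc,
    Finset.sort_toFinset]
  simp only [decide_eq_true_eq]

theorem le_getD_desc_iff (S : FibonacciSet N) (x : ℕ) {i : ℕ} (hi : i < S.carrier.card) :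
    x ≤ S.desc.getD i 0 ↔ i < countGe S.carrier x := by
  have hlen : i < S.desc.length := by rwa [length_desc]
  rw [List.getD_eq_getElem _ _ hlen, ← length_filter_desc]
  refine le_getElem_iff_of_pairwise_gt ?_ hlen
  have hsorted : S.desc.Pairwise (fun a b => a ≥ b) := S.carrier.pairwise_sort _
  have hnodup : S.desc.Nodup := S.carrier.sort_nodup _
  exact (hsorted.and hnodup).imp fun h => lt_of_le_of_ne h.1 h.2.symm

theorem le_iff_forall_countGe_le {S T : FibonacciSet N} :
    S ≤ T ↔ ∀ x, 1 ≤ x → countGe S.carrier x ≤ countGe T.carrier x := by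
  constructor
  · rintro ⟨hcard, hdesc⟩ x -
    by_contra! hlt
    have hle := countGe_le_card (C := S.carrier) (x := x)
    have hS := (S.le_getD_desc_iff x (i := countGe S.carrier x - 1) (by omega)).2 (by omega)
    have hT := (T.le_getD_desc_iff x (i := countGe S.carrier x - 1) (by omega)).1
      (hS.trans (hdesc _ (by omega)))
    omega
  · intro h
    have hcard : S.carrier.card ≤ T.carrier.card := by
      simpa only [countGe_of_le_one _ le_rfl] using h 1 le_rfl
    refine ⟨hcard, fun i hi => ?_⟩
    rcases Nat.eq_zero_or_pos (S.desc.getD i 0) with hzero | hpos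
    · omega
    · rw [le_getD_desc_iff _ _ (by omega)]
      exact ((S.le_getD_desc_iff _ hi).1 le_rfl).trans_le (h _ hpos)

/-- The carrier of the infimum of `A` and `B`: the set whose counting function is the minimum of the
counting functions of `A` and `B`. -/
def infCarrier (A B : FibonacciSet N) : Finset ℕ :=
  (Finset.Icc 1 N).filter fun x =>
    min (countGe A.carrier x) (countGe B.carrier x) =
      min (countGe A.carrier (x + 1)) (countGe B.carrier (x + 1)) + 1

theorem countGe_infCarrier (A B : FibonacciSet N) {x : ℕ} (hx : 1 ≤ x) :
    countGe (infCarrier A B) x = min (countGe A.carrier x) (countGe B.carrier x) := by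
  refine countGe_filter_eq_succ (f := fun y => min (countGe A.carrier y) (countGe B.carrier y))
    (fun y hy => ?_) (fun y => ?_) hx
  · simp only [countGe_of_lt _ hy, min_self]
  · have hA := countGe_eq_countGe_succ A.carrier y
    have hB := countGe_eq_countGe_succ B.carrier y
    split_ifs at hA hB <;> omega

theorem card_infCarrier_modEq (A B : FibonacciSet N) : (infCarrier A B).card ≡ N [MOD 2] := by
  have one_le : ∀ x ∈ infCarrier A B, 1 ≤ x := fun x hx =>
    (Finset.mem_Icc.1 (Finset.mem_filter.1 hx).1).1
  rw [← countGe_eq_card_of_forall_le one_le, countGe_infCarrier A B le_rfl,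
    countGe_of_le_one _ le_rfl, countGe_of_le_one _ le_rfl]
  rcases min_choice A.carrier.card B.carrier.card with h | h <;> rw [h]
  · exact A.card_parity
  · exact B.card_parity

theorem add_countGe_infCarrier_succ_modEq (A B : FibonacciSet N) {s : ℕ}
    (hs : s ∈ infCarrier A B) : s + countGe (infCarrier A B) (s + 1) ≡ N [MOD 2] := by
  have hdrop := (Finset.mem_filter.1 hs).2
  have hA := countGe_eq_countGe_succ A.carrier s
  have hB := countGe_eq_countGe_succ B.carrier s
  rw [countGe_infCarrier A B (by omega)]
  by_cases hsA : s ∈ A.carrier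
  · have pA := A.add_countGe_succ_modEq hsA
    by_cases hsB : s ∈ B.carrier
    · rcases min_choice (countGe A.carrier (s + 1)) (countGe B.carrier (s + 1)) with h | h <;>
        rw [h]
      · exact pA
      · exact B.add_countGe_succ_modEq hsB
    · rw [if_pos hsA] at hA
      rw [if_neg hsB] at hB
      rwa [min_eq_left (by omega)]
  · rw [if_neg hsA] at hA
    by_cases hsB : s ∈ B.carrier
    · rw [if_pos hsB] at hB
      rw [min_eq_right (by omega)]
      exact B.add_countGe_succ_modEq hsB
    · rw [if_neg hsB] at hB
      omega

theorem exists_isGLB_pair (A B : FibonacciSet N) : ∃ I, IsGLB {A, B} I := by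
  let I : FibonacciSet N := ofCountGe (infCarrier A B) (Finset.filter_subset _ _)
    (card_infCarrier_modEq A B) fun _ => add_countGe_infCarrier_succ_modEq A B
  have countGe_I : ∀ {x}, 1 ≤ x →
      countGe I.carrier x = min (countGe A.carrier x) (countGe B.carrier x) :=
    countGe_infCarrier A B
  refine ⟨I, ?_, fun C hC => le_iff_forall_countGe_le.2 fun x hx => ?_⟩
  · rintro C (rfl | rfl) <;> refine le_iff_forall_countGe_le.2 fun x hx => ?_ <;>
      rw [countGe_I hx]
    · exact min_le_left _ _
    · exact min_le_right _ _
  · rw [countGe_I hx]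
    exact le_min (le_iff_forall_countGe_le.1 (hC (.inl rfl)) x hx)
      (le_iff_forall_countGe_le.1 (hC (.inr rfl)) x hx)

/-! ## Free sets -/

/-- The largest element of `S` below `i`, or `0` if there is none; this is the maximum in the
definition of the free set. -/
def prev (S : FibonacciSet N) (i : ℕ) : ℕ := (S.carrier.filter (fun s => s < i)).sup id

theorem mem_freeSet_iff {S : FibonacciSet N} {i : ℕ} :
    i ∈ S.freeSet ↔ (1 ≤ i ∧ i ≤ N) ∧ i ∉ S.carrier ∧ (i - S.prev i) % 2 = 1 := by
  rw [freeSet, Finset.mem_filter, Finset.mem_Icc, prev, Nat.odd_iff]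

theorem prev_lt (S : FibonacciSet N) {i : ℕ} (hi : 1 ≤ i) : S.prev i < i := by
  rw [prev, Finset.sup_lt_iff (Nat.lt_of_succ_le hi)]
  exact fun s hs => (Finset.mem_filter.1 hs).2

theorem prev_succ (S : FibonacciSet N) (i : ℕ) :
    S.prev (i + 1) = if i ∈ S.carrier then i else S.prev i := by
  rw [prev]
  split_ifs with h
  · refine le_antisymm (Finset.sup_le fun s hs => ?_) ?_
    · exact Nat.le_of_lt_succ (Finset.mem_filter.1 hs).2
    · exact Finset.le_sup (f := id) (Finset.mem_filter.2 ⟨h, i.lt_succ_self⟩)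
  · rw [prev]
    congr 1
    refine Finset.filter_congr fun s hs => ?_
    have : s ≠ i := fun e => h (e ▸ hs)
    omega

theorem prev_add_countGe_modEq (S : FibonacciSet N) (i : ℕ) :
    S.prev i + countGe S.carrier i ≡ N [MOD 2] := by
  induction i with
  | zero =>
    have : S.prev 0 = 0 := by simp [prev]
    rw [this, countGe_of_le_one _ zero_le_one, zero_add]
    exact S.card_parity
  | succ i ih =>
    rw [prev_succ]
    split_ifs with h
    · exact S.add_countGe_succ_modEq h
    · rwa [countGe_eq_countGe_succ, if_neg h] at ih

variable {S : FibonacciSet N} {i : ℕ}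

theorem one_le_of_mem_freeSet (h : i ∈ S.freeSet) : 1 ≤ i := (mem_freeSet_iff.1 h).1.1

theorem notMem_carrier_of_mem_freeSet (h : i ∈ S.freeSet) : i ∉ S.carrier :=
  (mem_freeSet_iff.1 h).2.1

theorem succ_notMem_freeSet (h : i ∈ S.freeSet) : i + 1 ∉ S.freeSet := by
  rw [mem_freeSet_iff] at h ⊢
  rw [prev_succ, if_neg h.2.1]
  have := S.prev_lt h.1.1
  omega

theorem lt_of_mem_freeSet (h : i ∈ S.freeSet) : i < N := by
  rw [mem_freeSet_iff] at h
  by_contra hi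
  have hparity := S.prev_add_countGe_modEq (i + 1)
  rw [countGe_of_lt _ (by omega), prev_succ, if_neg h.2.1, Nat.ModEq] at hparity
  have := S.prev_lt h.1.1
  omega

theorem succ_notMem_carrier_of_mem_freeSet (h : i ∈ S.freeSet) : i + 1 ∉ S.carrier := by
  intro hsucc
  rw [mem_freeSet_iff] at h
  have hparity := S.prev_add_countGe_modEq (i + 1)
  have hparity_succ := S.add_countGe_succ_modEq hsucc
  rw [countGe_eq_countGe_succ _ (i + 1), if_pos hsucc, prev_succ, if_neg h.2.1] at hparity
  have := S.prev_lt h.1.1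
  rw [Nat.ModEq] at hparity hparity_succ
  omega

theorem exists_succ_eq_of_notMem (hi : 1 ≤ i) (hN : i ≤ N) (hcarrier : i ∉ S.carrier)
    (hfree : i ∉ S.freeSet) : ∃ j ∈ S.freeSet, j + 1 = i := by
  obtain ⟨j, rfl⟩ : ∃ j, i = j + 1 := ⟨i - 1, by omega⟩
  rw [mem_freeSet_iff, prev_succ] at hfree
  have hlt := S.prev_lt hi
  rw [prev_succ] at hlt
  have hj : j ∉ S.carrier := by
    intro hj
    rw [if_pos hj] at hfree
    exact hfree ⟨⟨hi, hN⟩, hcarrier, by omega⟩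
  rw [if_neg hj] at hfree hlt
  have heven : (j + 1 - S.prev j) % 2 ≠ 1 := fun h => hfree ⟨⟨hi, hN⟩, hcarrier, h⟩
  exact ⟨j, mem_freeSet_iff.2 ⟨⟨by omega, by omega⟩, hj, by omega⟩, rfl⟩

/-- The Fibonacci set of rank `N + 1` obtained from `S` by adding the element `N + 1`. -/
def insertTop (S : FibonacciSet N) : FibonacciSet (N + 1) :=
  have htop : N + 1 ∉ S.carrier := fun h => by have := le_of_mem h; omega
  ofCountGe (insert (N + 1) S.carrier)
    (Finset.insert_subset (Finset.mem_Icc.2 ⟨by omega, le_rfl⟩)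
      (S.subset_Icc.trans (Finset.Icc_subset_Icc_right N.le_succ)))
    (by
      rw [Finset.card_insert_of_notMem htop]
      exact S.card_parity.add_right 1)
    (by
      intro s hs
      rw [countGe_insert htop]
      rcases Finset.mem_insert.1 hs with rfl | hs
      · rw [S.countGe_of_lt (by omega), if_neg (by omega)]
      · rw [if_pos (Nat.succ_le_succ (le_of_mem hs))]
        exact (S.add_countGe_succ_modEq hs).add_right 1)

/-- The Fibonacci set `S` of rank `N`, regarded as one of rank `N + 2`. -/
def lift (S : FibonacciSet N) : FibonacciSet (N + 2) :=
  ofCountGe S.carrier (S.subset_Icc.trans (Finset.Icc_subset_Icc_right (by omega)))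
    (S.card_parity.trans (by rw [Nat.ModEq]; omega))
    (fun s hs => (S.add_countGe_succ_modEq hs).trans (by rw [Nat.ModEq]; omega))

theorem freeSet_insertTop (S : FibonacciSet N) : S.insertTop.freeSet = S.freeSet := by
  have hcarrier : S.insertTop.carrier = insert (N + 1) S.carrier := rfl
  have hprev : ∀ i ≤ N + 1, S.insertTop.prev i = S.prev i := fun i hi => by
    rw [prev, hcarrier, Finset.filter_insert, if_neg (by omega), prev]
  ext i
  rw [mem_freeSet_iff, mem_freeSet_iff, hcarrier, Finset.mem_insert, not_or]
  constructor
  · rintro ⟨hi, ⟨hne, hmem⟩, hodd⟩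
    exact ⟨by omega, hmem, by rwa [← hprev i hi.2]⟩
  · rintro ⟨hi, hmem, hodd⟩
    exact ⟨by omega, ⟨by omega, hmem⟩, by rwa [hprev i (by omega)]⟩

theorem freeSet_lift (S : FibonacciSet N) : S.lift.freeSet = insert (N + 1) S.freeSet := by
  have hprev : ∀ i, S.lift.prev i = S.prev i := fun _ => rfl
  have hcarrier : S.lift.carrier = S.carrier := rfl
  have htop : N + 1 ∉ S.carrier := fun h => by have := le_of_mem h; omega
  have hlt := S.prev_lt (i := N + 1) (by omega)
  have hparity := S.prev_add_countGe_modEq (N + 1)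
  rw [countGe_of_lt _ (by omega), Nat.ModEq] at hparity
  ext i
  rw [Finset.mem_insert, mem_freeSet_iff, mem_freeSet_iff, hprev, hcarrier]
  constructor
  · rintro ⟨hi, hmem, hodd⟩
    rcases Nat.lt_trichotomy i (N + 1) with hlow | rfl | hhigh
    · exact .inr ⟨by omega, hmem, hodd⟩
    · exact .inl rfl
    · obtain rfl : i = N + 2 := by omega
      rw [prev_succ, if_neg htop] at hodd
      omega
  · rintro (rfl | ⟨hi, hmem, hodd⟩)
    · exact ⟨by omega, htop, by omega⟩
    · exact ⟨by omega, hmem, hodd⟩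

/-- The word of the free element: the free set in increasing order. -/
def freeWord (S : FibonacciSet N) : List ℕ := S.freeSet.sort (fun a b => a ≤ b)

theorem mem_freeWord : i ∈ S.freeWord ↔ i ∈ S.freeSet := Finset.mem_sort _

theorem nodup_freeWord (S : FibonacciSet N) : S.freeWord.Nodup := Finset.sort_nodup _ _

theorem length_freeWord (S : FibonacciSet N) : S.freeWord.length = S.freeSet.card :=
  Finset.length_sort _

theorem forall_mem_freeWord (S : FibonacciSet N) : ∀ i ∈ S.freeWord, 1 ≤ i ∧ i < N :=
  fun _ hi => ⟨one_le_of_mem_freeSet (mem_freeWord.1 hi), lt_of_mem_freeSet (mem_freeWord.1 hi)⟩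

theorem freeWord_insertTop (S : FibonacciSet N) : S.insertTop.freeWord = S.freeWord := by
  rw [freeWord, freeSet_insertTop, freeWord]

theorem freeWord_lift (S : FibonacciSet N) : S.lift.freeWord = S.freeWord ++ [N + 1] := by
  have hlt : ∀ i ∈ S.freeWord, i < N + 1 := fun i hi =>
    ((S.forall_mem_freeWord i hi).2).trans N.lt_succ_self
  have hsorted : (S.freeWord ++ [N + 1]).Pairwise (· ≤ ·) := by
    refine List.pairwise_append.2 ⟨Finset.pairwise_sort _ _, List.pairwise_singleton _ _, ?_⟩
    exact fun a ha b hb => List.mem_singleton.1 hb ▸ (hlt a ha).le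
  have hnodup : (S.freeWord ++ [N + 1]).Nodup :=
    S.nodup_freeWord.append (List.nodup_singleton _)
      (List.disjoint_singleton.2 fun h => (hlt _ h).false)
  refine List.Perm.eq_of_pairwise' (Finset.pairwise_sort _ _) hsorted ?_
  refine (List.perm_ext_iff_of_nodup (nodup_freeWord _) hnodup).2 fun a => ?_
  rw [mem_freeWord, freeSet_lift, Finset.mem_insert, List.mem_append, mem_freeWord,
    List.mem_singleton, or_comm]

end FibonacciSet

/-! ## Triangular factorizations of words -/

/-- Every last letter of `u` is at the level of `F`: whenever `c` is the last among the letters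
`c` and `c + 1` of `u`, one of `c` and `c + 1` lies in `F`. With `F` the free set, it is this
condition on both outer factors that makes a triangular factorization unique. -/
def EndsIn (F : Finset ℕ) (u : List ℕ) : Prop :=
  ∀ c, [c] <:+ adjFilter c u → c ∈ F ∨ c + 1 ∈ F

theorem EndsIn.of_traceEq {F : Finset ℕ} {u v : List ℕ} (h : EndsIn F u) (huv : TraceEq u v) :
    EndsIn F v := fun c hc => h c (by rwa [huv c])

theorem singleton_suffix_append {α : Type*} {c : α} {u v : List α} (h : [c] <:+ u ++ v) :
    [c] <:+ v ∨ v = [] ∧ [c] <:+ u := by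
  rcases v.eq_nil_or_concat with rfl | ⟨v, b, rfl⟩
  · exact .inr ⟨rfl, by simpa using h⟩
  · rw [List.concat_eq_append] at h ⊢
    rw [← List.append_assoc] at h
    obtain ⟨-, hcb⟩ := List.append_inj' (h.choose_spec) rfl
    exact .inl (hcb ▸ List.suffix_append v [c])

theorem EndsIn.Ico_append {F : Finset ℕ} {u : List ℕ} {k : ℕ} (h : EndsIn F u) (m : ℕ) :
    EndsIn (insert (k + 1) F) (List.Ico m (k + 1) ++ u) := by
  intro c hc
  rw [adjFilter_append] at hc
  rcases singleton_suffix_append hc with hcu | ⟨-, hcIco⟩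
  · exact (h c hcu).imp (Finset.mem_insert_of_mem ·) (Finset.mem_insert_of_mem ·)
  · have hmem := List.Ico.mem.1 (mem_adjFilter.1 (hcIco.mem (List.mem_singleton_self c))).1
    obtain rfl : c = k := by
      by_contra hck
      exact not_suffix_adjFilter_Ico (by omega) hcIco
    exact .inr (Finset.mem_insert_self _ _)

/-- A factorization of the word `w`, up to commutations, through the free word of `S`, both of
whose outer factors turn towards the free word only letters at its level. -/
structure TriangularWord {N : ℕ} (w : List ℕ) (S : FibonacciSet N) (ρ τ : List ℕ) : Prop where
  traceEq : TraceEq w (ρ ++ S.freeWord ++ τ)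
  left : EndsIn S.freeSet ρ
  right : EndsIn S.freeSet τ.reverse

namespace TriangularWord

variable {N : ℕ} {w ρ τ : List ℕ} {S : FibonacciSet N}

theorem of_traceEq {w' ρ' τ' : List ℕ} (h : TriangularWord w S ρ τ) (hw : TraceEq w' w)
    (hρ : TraceEq ρ ρ') (hτ : TraceEq τ τ') : TriangularWord w' S ρ' τ' where
  traceEq := hw.trans (h.traceEq.trans ((hρ.append_right _).append hτ))
  left := h.left.of_traceEq hρ
  right := h.right.of_traceEq hτ.reverse

theorem forall_mem_left {p : ℕ → Prop} (h : TriangularWord w S ρ τ) (hw : ∀ i ∈ w, p i) :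
    ∀ i ∈ ρ, p i := fun i hi => hw i ((h.traceEq.mem_iff i).2 (by simp [hi]))

theorem forall_mem_right {p : ℕ → Prop} (h : TriangularWord w S ρ τ) (hw : ∀ i ∈ w, p i) :
    ∀ i ∈ τ, p i := fun i hi => hw i ((h.traceEq.mem_iff i).2 (by simp [hi]))

/-! ### Existence -/

theorem insertTop (h : TriangularWord w S ρ τ) : TriangularWord w S.insertTop ρ τ where
  traceEq := by rw [FibonacciSet.freeWord_insertTop]; exact h.traceEq
  left := by rw [FibonacciSet.freeSet_insertTop]; exact h.left
  right := by rw [FibonacciSet.freeSet_insertTop]; exact h.right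

theorem lift (h : TriangularWord w S ρ τ) (hw : ∀ i ∈ w, i < N) {m : ℕ} (hm : m ≤ N + 1) (m' : ℕ) :
    TriangularWord (List.Ico m (N + 2) ++ (w ++ (List.Ico m' (N + 1)).reverse)) S.lift
      (List.Ico m (N + 1) ++ ρ) (τ ++ (List.Ico m' (N + 1)).reverse) where
  traceEq := by
    have hlt : ∀ i ∈ ρ ++ S.freeWord, i < N := by
      intro i hi
      rcases List.mem_append.1 hi with hi | hi
      · exact h.forall_mem_left hw i hi
      · exact (S.forall_mem_freeWord i hi).2
    have top_comm : TraceEq ([N + 1] ++ (ρ ++ S.freeWord)) (ρ ++ S.freeWord ++ [N + 1]) :=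
      .append_comm fun a ha b hb => by
        have := hlt b hb
        rw [List.mem_singleton] at ha
        omega
    have hw_top : TraceEq ([N + 1] ++ w) (ρ ++ S.freeWord ++ [N + 1] ++ τ) :=
      (h.traceEq.append_left [N + 1]).trans (by simpa using top_comm.append_right τ)
    rw [FibonacciSet.freeWord_lift, ← List.Ico.append_consecutive hm (Nat.le_succ _),
      List.Ico.succ_singleton]
    simpa using (hw_top.append_left (List.Ico m (N + 1))).append_right
      (List.Ico m' (N + 1)).reverse
  left := by
    rw [FibonacciSet.freeSet_lift]
    exact h.left.Ico_append m
  right := by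
    rw [FibonacciSet.freeSet_lift, List.reverse_append, List.reverse_reverse]
    exact h.right.Ico_append m'

end TriangularWord

theorem ReducedWord.exists_triangularWord {N : ℕ} {w : List ℕ} (h : ReducedWord w)
    (hw : ∀ i ∈ w, 1 ≤ i ∧ i < N) :
    ∃ (S : FibonacciSet N) (ρ τ : List ℕ), TriangularWord w S ρ τ := by
  induction N using Nat.strong_induction_on generalizing w with
  | _ N ih =>
  match N, ih with
  | 0, _ =>
    obtain rfl : w = [] :=
      List.eq_nil_iff_forall_not_mem.2 fun i hi => Nat.not_lt_zero i (hw i hi).2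
    let S : FibonacciSet 0 := .ofCountGe ∅ (Finset.empty_subset _) rfl (by simp)
    have hS : S.freeWord = [] := List.eq_nil_iff_forall_not_mem.2 fun i hi =>
      Nat.not_lt_zero i (S.forall_mem_freeWord i hi).2
    exact ⟨S, [], [], by rw [hS]; exact .refl _, by simp [EndsIn], by simp [EndsIn]⟩
  | N + 1, ih =>
    by_cases hN : N ∈ w
    · obtain ⟨k, rfl⟩ : ∃ k, N = k + 1 := ⟨N - 1, by have := hw N hN; omega⟩
      obtain ⟨m, u, -, -, hu, hwu⟩ := h.exists_traceEq_Ico_append hw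
      have hm : m ≤ k + 1 := by
        rcases List.mem_append.1 ((hwu.mem_iff _).1 hN) with hmem | hmem
        · exact (List.Ico.mem.1 hmem).1
        · exact absurd (hu _ hmem).2 (lt_irrefl _)
      have hu_red : ReducedWord u.reverse := (hwu.reducedWord h).of_append_right.reverse
      obtain ⟨m', v, -, -, hv, huv⟩ := hu_red.exists_traceEq_Ico_append fun i hi =>
        hu i (List.mem_reverse.1 hi)
      obtain ⟨S, ρ, τ, hS⟩ := ih k (by omega) (huv.reducedWord hu_red).of_append_right.reverse
        fun i hi => hv i (List.mem_reverse.1 hi)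
      have hu_eq : TraceEq u (v.reverse ++ (List.Ico m' (k + 1)).reverse) := by
        simpa using huv.reverse
      exact ⟨S.lift, _, _, (hS.lift (fun i hi => (hv i (List.mem_reverse.1 hi)).2) hm m').of_traceEq
        (hwu.trans (hu_eq.append_left _)) (.refl _) (.refl _)⟩
    · obtain ⟨S, ρ, τ, hS⟩ := ih N (by omega) h fun i hi =>
        ⟨(hw i hi).1, Nat.lt_of_le_of_ne (Nat.le_of_lt_succ (hw i hi).2) fun e => hN (e ▸ hi)⟩
      exact ⟨S.insertTop, ρ, τ, hS.insertTop⟩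

/-! ### Uniqueness -/

theorem FibonacciSet.adjFilter_freeWord {N : ℕ} (S : FibonacciSet N) (c : ℕ) :
    adjFilter c S.freeWord = [] ∨ ∃ a, adjFilter c S.freeWord = [a] := by
  have hnodup : (adjFilter c S.freeWord).Nodup := S.nodup_freeWord.filter _
  have hcard : (adjFilter c S.freeWord).toFinset.card ≤ 1 := by
    rw [Finset.card_le_one]
    simp only [List.mem_toFinset, mem_adjFilter, mem_freeWord]
    rintro a ⟨ha, rfl | rfl⟩ b ⟨hb, rfl | rfl⟩
    · rfl
    · exact absurd hb (succ_notMem_freeSet ha)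
    · exact absurd ha (succ_notMem_freeSet hb)
    · rfl
  rw [List.toFinset_card_of_nodup hnodup] at hcard
  rcases Nat.le_one_iff_eq_zero_or_eq_one.1 hcard with h | h
  · exact .inl (List.length_eq_zero_iff.1 h)
  · exact .inr (List.length_eq_one_iff.1 h)

theorem FibonacciSet.adjFilter_freeWord_ne_nil {N : ℕ} {S : FibonacciSet N} {c : ℕ}
    (h : c ∈ S.freeSet ∨ c + 1 ∈ S.freeSet) : adjFilter c S.freeWord ≠ [] := by
  rcases h with h | h
  · exact List.ne_nil_of_mem (mem_adjFilter.2 ⟨mem_freeWord.2 h, .inl rfl⟩)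
  · exact List.ne_nil_of_mem (mem_adjFilter.2 ⟨mem_freeWord.2 h, .inr rfl⟩)

theorem eq_nil_of_cons_eq_append_cons {α : Type*} {a c : α} {d s t : List α}
    (h : a :: s = d ++ a :: t) (hd : ∀ x ∈ d, x = c) (hs : ¬ [c, c] <+: a :: s) : d = [] := by
  match d with
  | [] => rfl
  | [x] =>
    obtain rfl : x = c := hd x (by simp)
    simp only [List.cons_append, List.nil_append, List.cons.injEq] at h
    obtain ⟨rfl, rfl⟩ := h
    exact absurd ⟨t, rfl⟩ hs
  | x :: y :: d =>
    obtain rfl : x = c := hd x (by simp)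
    obtain rfl : y = x := hd y (by simp)
    exact absurd ⟨d ++ a :: t, by rw [h]; rfl⟩ hs

theorem forall_mem_eq_of_adjFilter_eq_append {c : ℕ} {u v d : List ℕ}
    (h : adjFilter c u = adjFilter c v ++ d) (hcount : u.count (c + 1) = v.count (c + 1)) :
    ∀ x ∈ d, x = c := by
  have hd : d.count (c + 1) = 0 := by
    rw [← count_adjFilter_succ c u, ← count_adjFilter_succ c v, h, List.count_append] at hcount
    omega
  intro x hx
  have hmem : x ∈ adjFilter c u := h ▸ List.mem_append_right _ hx
  exact (mem_adjFilter.1 hmem).2.resolve_right fun e => List.count_eq_zero.1 hd (e ▸ hx)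

namespace TriangularWord

variable {N : ℕ} {w ρ τ ρ' τ' : List ℕ} {S : FibonacciSet N}

theorem adjFilter_left_eq_of_count_succ_eq (h : TriangularWord w S ρ τ) (hred : ReducedWord w)
    (h' : TraceEq w (ρ' ++ S.freeWord ++ τ')) {c : ℕ}
    (hcount : ρ'.count (c + 1) = ρ.count (c + 1)) : adjFilter c ρ' = adjFilter c ρ := by
  have hw := h.traceEq c
  have hw' := h'.symm c
  simp only [adjFilter_append, List.append_assoc] at hw hw'
  have hred_c := hred c
  have no_repeat : ∀ {a s : List ℕ}, adjFilter c w = a ++ s → ¬ [c, c] <+: s := fun e hs =>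
    hred_c (e ▸ hs.isInfix.trans (List.suffix_append _ _).isInfix)
  -- One of the two subwords continues the other, and what it has in addition is a power of `c`.
  rcases List.append_eq_append_iff.1 (hw'.trans hw) with ⟨d, hd, e⟩ | ⟨d, hd, e⟩
  · have hdc := forall_mem_eq_of_adjFilter_eq_append hd hcount.symm
    suffices d = [] by rw [hd, this, List.append_nil]
    rcases S.adjFilter_freeWord c with hf | ⟨a, hf⟩
    · by_contra hne
      have hlast : [c] <:+ d := by
        rw [← hdc _ (List.getLast_mem hne)]
        exact ⟨d.dropLast, List.dropLast_append_getLast hne⟩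
      refine FibonacciSet.adjFilter_freeWord_ne_nil (h.left c ?_) hf
      exact hd ▸ hlast.trans (List.suffix_append _ _)
    · rw [hf] at e hw'
      exact eq_nil_of_cons_eq_append_cons e hdc (no_repeat hw'.symm)
  · have hdc := forall_mem_eq_of_adjFilter_eq_append hd hcount
    suffices d = [] by rw [hd, this, List.append_nil]
    rcases S.adjFilter_freeWord c with hf | ⟨a, hf⟩
    · by_contra hne
      have hhead : [c] <+: d := by
        rw [← hdc _ (List.head_mem hne)]
        exact ⟨d.tail, List.cons_head_tail hne⟩
      refine FibonacciSet.adjFilter_freeWord_ne_nil (h.right c ?_) hf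
      rw [hf, List.nil_append, List.nil_append] at e
      rw [adjFilter_reverse, ← List.reverse_singleton, List.reverse_suffix, e]
      exact hhead.trans (List.prefix_append _ _)
    · rw [hf] at e hw
      exact eq_nil_of_cons_eq_append_cons e hdc (no_repeat hw)

/-- By downward induction on `c`: both counts vanish for large `c`. -/
theorem count_left_eq (h : TriangularWord w S ρ τ) (hred : ReducedWord w)
    (h' : TraceEq w (ρ' ++ S.freeWord ++ τ')) (c : ℕ) : ρ'.count c = ρ.count c := by
  have step : ∀ c, ρ'.count (c + 1) = ρ.count (c + 1) → ρ'.count c = ρ.count c := fun c hc => by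
    rw [← count_adjFilter_self c ρ', h.adjFilter_left_eq_of_count_succ_eq hred h' hc,
      count_adjFilter_self]
  have hbound : ∀ i ∈ ρ' ++ ρ, i < (ρ' ++ ρ).sum + 1 := fun i hi =>
    Nat.lt_succ_of_le (List.single_le_sum (fun _ _ => Nat.zero_le _) i hi)
  have htop : ∀ k, ρ'.count (c + k) = ρ.count (c + k) → ρ'.count c = ρ.count c := by
    intro k
    induction k with
    | zero => exact id
    | succ k ih => exact fun hk => ih (step _ hk)
  have hzero : ∀ i ≥ (ρ' ++ ρ).sum + 1, ρ'.count i = ρ.count i := fun i hi => by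
    rw [List.count_eq_zero.2 fun hmem => (hbound i (List.mem_append_left _ hmem)).not_ge hi,
      List.count_eq_zero.2 fun hmem => (hbound i (List.mem_append_right _ hmem)).not_ge hi]
  exact htop _ (hzero _ (Nat.le_add_left _ _))

theorem unique (h : TriangularWord w S ρ τ) (hred : ReducedWord w)
    (h' : TraceEq w (ρ' ++ S.freeWord ++ τ')) : TraceEq ρ' ρ ∧ TraceEq τ' τ := by
  have hρ : TraceEq ρ' ρ := fun c =>
    h.adjFilter_left_eq_of_count_succ_eq hred h' (h.count_left_eq hred h' (c + 1))
  refine ⟨hρ, TraceEq.of_append_left (u := ρ ++ S.freeWord) ?_⟩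
  exact ((hρ.symm.append_right _).append_right _).trans (h'.symm.trans h.traceEq)

end TriangularWord

/-! ## Labelled perfect matchings -/

/-- A perfect matching of `V` whose pairs carry labels. An arc-diagram without loops is such a
matching of its boundary nodes. -/
@[ext]
structure LabelledMatching (V : Type*) where
  partner : V → V
  label : V → ℕ
  partner_partner : ∀ v, partner (partner v) = v
  partner_ne : ∀ v, partner v ≠ v
  label_partner : ∀ v, label (partner v) = label v

namespace LabelledMatching

section Join

variable {V : Type*} [DecidableEq V] (M : LabelledMatching V) {p q : V} (hpq : p ≠ q) (l : ℕ)

/-- Joins `p` and `q` by a strand of label `l`, and attaches a new pair of label `l` to `p` and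
`q`. -/
def join (M : LabelledMatching V) (p q : V) (hpq : p ≠ q) (l : ℕ) : LabelledMatching V where
  partner v := if v = p then q else if v = q then p else
    if M.partner v = p then M.partner q else if M.partner v = q then M.partner p else M.partner v
  label v := if v = p ∨ v = q then l else
    if M.partner v = p ∨ M.partner v = q then min (min (M.label p) (M.label q)) l else M.label v
  partner_partner v := by
    have hinvol := M.partner_partner
    have hne := M.partner_ne
    grind
  partner_ne v := by
    have hinvol := M.partner_partner
    have hne := M.partner_ne
    grind
  label_partner v := by
    have hinvol := M.partner_partner
    have hne := M.partner_ne
    have hlabel := M.label_partner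
    grind

theorem join_comm {r s : V} (hrs : r ≠ s) (hpr : p ≠ r) (hps : p ≠ s) (hqr : q ≠ r) (hqs : q ≠ s)
    (m : ℕ) : (M.join p q hpq l).join r s hrs m = (M.join r s hrs m).join p q hpq l := by
  have hinvol := M.partner_partner
  ext v
  · have hinj : ∀ a b, M.partner a = M.partner b → a = b :=
      fun a b hab => by rw [← hinvol a, hab, hinvol]
    simp only [join]
    grind (splits := 30)
  · have hlabel := M.label_partner
    simp only [join]
    grind (splits := 30)

end Join

section Arcs

variable {N : ℕ} (M : LabelledMatching (Fin N ⊕ Fin N))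

/-- The arc-diagram of a matching of the boundary nodes. -/
def toArcs : LabelledArcs N :=
  {p | ∃ v, p = (s(v, M.partner v), M.label v)}

theorem mem_toArcs {a b : Fin N ⊕ Fin N} {h : ℕ} :
    (s(a, b), h) ∈ M.toArcs ↔ b = M.partner a ∧ h = M.label a := by
  constructor
  · rintro ⟨v, hv⟩
    rw [Prod.mk.injEq, Sym2.eq_iff] at hv
    rcases hv with ⟨⟨rfl, rfl⟩ | ⟨rfl, rfl⟩, rfl⟩
    · exact ⟨rfl, rfl⟩
    · exact ⟨(M.partner_partner _).symm, (M.label_partner _).symm⟩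
  · rintro ⟨rfl, rfl⟩
    exact ⟨a, rfl⟩

theorem propLab_toArcs : M.toArcs.propLab =
    {h | ∃ a b, M.partner (Sum.inl a) = Sum.inr b ∧ M.label (Sum.inl a) = h} := by
  ext h
  simp only [LabelledArcs.propLab, Set.mem_ofPred_eq, mem_toArcs]
  exact exists_congr fun a => exists_congr fun b => and_congr eq_comm eq_comm

end Arcs

end LabelledMatching

/-- The matching of the identity diagram. -/
def idMatching (N : ℕ) : LabelledMatching (Fin N ⊕ Fin N) where
  partner := Sum.swap
  label := Sum.elim (fun j => j + 1) (fun j => j + 1)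
  partner_partner v := by simp
  partner_ne v := by cases v <;> simp
  label_partner v := by cases v <;> simp

theorem toArcs_idMatching (N : ℕ) : (idMatching N).toArcs = LabelledArcs.identity N := by
  ext p
  constructor
  · rintro ⟨v | v, rfl⟩
    · exact ⟨v, rfl⟩
    · exact ⟨v, by rw [Sym2.eq_swap]; rfl⟩
  · rintro ⟨j, rfl⟩
    exact ⟨Sum.inl j, rfl⟩

/-! ## Composition with an elementary diagram -/

namespace LabelledArcs

open LabelledMatching

variable {N : ℕ} {C D : LabelledArcs N} {u v : GluedNode N} {h : ℕ}

theorem fragment_iff : Fragment C D u v h ↔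
    (∃ e, (e, h) ∈ C ∧ s(u, v) = e.map fstNode) ∨
      ∃ e, (e, h) ∈ D ∧ s(u, v) = e.map sndNode := by
  have unordered : ∀ (E : LabelledArcs N) (φ : Fin N ⊕ Fin N → GluedNode N),
      (∃ a b, (s(a, b), h) ∈ E ∧ u = φ a ∧ v = φ b) ↔
        ∃ e, (e, h) ∈ E ∧ s(u, v) = e.map φ := by
    intro E φ
    constructor
    · rintro ⟨a, b, hab, rfl, rfl⟩
      exact ⟨s(a, b), hab, rfl⟩
    · rintro ⟨e, he, huv⟩
      induction e with | _ a b
      rw [Sym2.map_mk, Sym2.eq_iff] at huv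
      rcases huv with ⟨rfl, rfl⟩ | ⟨rfl, rfl⟩
      · exact ⟨a, b, he, rfl, rfl⟩
      · exact ⟨b, a, Sym2.eq_swap ▸ he, rfl, rfl⟩
  exact or_congr (unordered C fstNode) (unordered D sndNode)

theorem Fragment.symm (huv : Fragment C D u v h) : Fragment C D v u h := by
  rw [fragment_iff, Sym2.eq_swap] at huv
  exact fragment_iff.2 huv

theorem Linked.symm (huv : Linked C D u v) : Linked C D v u :=
  have : Std.Symm fun u v => ∃ h, Fragment C D u v h := ⟨fun _ _ => Exists.imp fun _ => .symm⟩
  Relation.ReflTransGen.stdSymm.symm _ _ huv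

variable {M : LabelledMatching (Fin N ⊕ Fin N)}

theorem fragment_sndNode (a : Fin N ⊕ Fin N) :
    Fragment C M.toArcs (sndNode a) (sndNode (M.partner a)) (M.label a) :=
  .inr ⟨a, _, ⟨a, rfl⟩, rfl, rfl⟩

/-- The boundary nodes `a` and `b` lie on the same concatenated arc, and `h` is the label of one
of its fragments. -/
def LinkedWithLabel (C D : LabelledArcs N) (a b : Fin N ⊕ Fin N) (h : ℕ) : Prop :=
  Linked C D (outerNode a) (outerNode b) ∧
    ∃ u v, Linked C D (outerNode a) u ∧ Fragment C D u v h

theorem comp_eq_toArcs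
    (hlinked : ∀ a, LinkedWithLabel C D a (M.partner a) (M.label a))
    (hpartner : ∀ a b, Linked C D (outerNode a) (outerNode b) → a = b ∨ b = M.partner a)
    (hlabel : ∀ a u v h, Linked C D (outerNode a) u → Fragment C D u v h → M.label a ≤ h) :
    comp C D = M.toArcs := by
  have hleast : ∀ a, IsLeast {h | ∃ u v, Linked C D (outerNode a) u ∧ Fragment C D u v h}
      (M.label a) := fun a => ⟨(hlinked a).2, fun h ⟨u, v, hu, huv⟩ => hlabel a u v h hu huv⟩
  ext ⟨e, h⟩
  constructor
  · rintro ⟨a, b, hab, rfl, hl, hh⟩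
    exact (mem_toArcs M).2 ⟨(hpartner a b hl).resolve_left hab, hh.unique (hleast a)⟩
  · rintro ⟨a, ha⟩
    obtain ⟨rfl, rfl⟩ := Prod.mk.inj ha
    exact ⟨a, _, (M.partner_ne a).symm, rfl, (hlinked a).1, hleast a⟩

/-- Extends a function on the boundary nodes to all nodes of a composition with an elementary
diagram; the middle nodes `p` and `q`, which may lie on a loop, get the value `d`. -/
def glueExtend {α : Type*} (f : Fin N ⊕ Fin N → α) (p q : Fin N) (d : α) : GluedNode N → α
  | .left j => f (Sum.inl j)
  | .right j => f (Sum.inr j)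
  | .mid j => if j = p ∨ j = q then d else f (Sum.inl j)

theorem glueExtend_outerNode {α : Type*} (f : Fin N ⊕ Fin N → α) (p q : Fin N) (d : α)
    (a : Fin N ⊕ Fin N) : glueExtend f p q d (outerNode a) = f a := by
  cases a <;> rfl

theorem glueExtend_sndNode {α : Type*} (f : Fin N ⊕ Fin N → α) (p q : Fin N) (d : α)
    (a : Fin N ⊕ Fin N) : glueExtend f p q d (sndNode a) =
      if a = Sum.inl p ∨ a = Sum.inl q then d else f a := by
  cases a <;> simp [glueExtend, sndNode]

variable {i : ℕ} {p q : Fin N} (hpq : s((p : ℕ) + 1, (q : ℕ) + 1) = s(i, i + 1))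

include hpq

theorem inl_ne_inl : (Sum.inl p : Fin N ⊕ Fin N) ≠ Sum.inl q := by
  rintro ⟨rfl⟩
  simp only [Sym2.eq_iff] at hpq
  omega

theorem mem_elementary {e : Sym2 (Fin N ⊕ Fin N)} : (e, h) ∈ elementary N i ↔
    (∃ j, j ≠ p ∧ j ≠ q ∧ h = j + 1 ∧ e = s(Sum.inl j, Sum.inr j)) ∨
      h = i ∧ (e = s(Sum.inl p, Sum.inl q) ∨ e = s(Sum.inr p, Sum.inr q)) := by
  have hends : ∀ j : Fin N, (j : ℕ) + 1 ≠ i ∧ (j : ℕ) + 1 ≠ i + 1 ↔ j ≠ p ∧ j ≠ q := by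
    intro j
    simp only [Sym2.eq_iff] at hpq
    simp only [ne_eq, Fin.ext_iff]
    omega
  have hpair : ∀ (φ : Fin N → Fin N ⊕ Fin N) (a b : Fin N), (a : ℕ) + 1 = i →
      (b : ℕ) + 1 = i + 1 → s(φ a, φ b) = s(φ p, φ q) := by
    intro φ a b ha hb
    have hval : Sym2.map Fin.val s(a, b) = Sym2.map Fin.val s(p, q) := by
      simp only [Sym2.map_mk, Sym2.eq_iff] at hpq ⊢
      omega
    exact congrArg (Sym2.map φ) (Sym2.map.injective Fin.val_injective hval)
  constructor
  · rintro (⟨j, h₁, h₂, hj⟩ | ⟨a, b, ha, hb, hab⟩)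
    · obtain ⟨rfl, rfl⟩ := Prod.mk.inj hj
      obtain ⟨hjp, hjq⟩ := (hends j).1 ⟨h₁, h₂⟩
      exact .inl ⟨j, hjp, hjq, rfl, rfl⟩
    · rw [hpair .inl a b ha hb, hpair .inr a b ha hb, Prod.mk.injEq, Prod.mk.injEq, ← or_and_right,
        and_comm] at hab
      exact .inr hab
  · rintro (⟨j, hjp, hjq, rfl, rfl⟩ | ⟨rfl, he⟩)
    · obtain ⟨h₁, h₂⟩ := (hends j).2 ⟨hjp, hjq⟩
      exact .inl ⟨j, h₁, h₂, rfl⟩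
    · obtain ⟨a, b, ha, hb⟩ : ∃ a b : Fin N, (a : ℕ) + 1 = h ∧ (b : ℕ) + 1 = h + 1 := by
        rcases Sym2.eq_iff.1 hpq with ⟨hp, hq⟩ | ⟨hp, hq⟩
        exacts [⟨p, q, hp, hq⟩, ⟨q, p, hq, hp⟩]
      rw [← hpair .inl a b ha hb, ← hpair .inr a b ha hb] at he
      exact .inr ⟨a, b, ha, hb, he.imp (congrArg (·, h)) (congrArg (·, h))⟩

theorem fragment_elementary_iff : Fragment (elementary N i) M.toArcs u v h ↔
    (∃ j, j ≠ p ∧ j ≠ q ∧ h = j + 1 ∧ s(u, v) = s(.left j, .mid j)) ∨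
      (h = i ∧ (s(u, v) = s(.left p, .left q) ∨ s(u, v) = s(.mid p, .mid q))) ∨
        ∃ a, s(u, v) = s(sndNode a, sndNode (M.partner a)) ∧ h = M.label a := by
  rw [fragment_iff, ← or_assoc]
  refine or_congr ?_ ?_
  · simp only [mem_elementary hpq]
    constructor
    · rintro ⟨e, ⟨j, hjp, hjq, rfl, rfl⟩ | ⟨rfl, rfl | rfl⟩, huv⟩
      · exact .inl ⟨j, hjp, hjq, rfl, huv⟩
      · exact .inr ⟨rfl, .inl huv⟩
      · exact .inr ⟨rfl, .inr huv⟩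
    · rintro (⟨j, hjp, hjq, rfl, huv⟩ | ⟨rfl, huv | huv⟩)
      · exact ⟨_, .inl ⟨j, hjp, hjq, rfl, rfl⟩, huv⟩
      · exact ⟨_, .inr ⟨rfl, .inl rfl⟩, huv⟩
      · exact ⟨_, .inr ⟨rfl, .inr rfl⟩, huv⟩
  · constructor
    · rintro ⟨_, ⟨a, ha⟩, huv⟩
      obtain ⟨rfl, rfl⟩ := Prod.mk.inj ha
      exact ⟨a, huv, rfl⟩
    · rintro ⟨a, huv, rfl⟩
      exact ⟨_, ⟨a, rfl⟩, huv⟩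

theorem linked_outerNode_sndNode {a : Fin N ⊕ Fin N} (hap : a ≠ Sum.inl p) (haq : a ≠ Sum.inl q) :
    Linked (elementary N i) M.toArcs (outerNode a) (sndNode a) := by
  rcases a with j | j
  · exact .single ⟨j + 1, (fragment_elementary_iff hpq).2
      (.inl ⟨j, by simpa using hap, by simpa using haq, rfl, rfl⟩)⟩
  · exact .refl

theorem linkedWithLabel_inl :
    LinkedWithLabel (elementary N i) M.toArcs (Sum.inl p) (Sum.inl q) i := by
  have hfragment : Fragment (elementary N i) M.toArcs (.left p) (.left q) i :=
    (fragment_elementary_iff hpq).2 (.inr (.inl ⟨rfl, .inl rfl⟩))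
  exact ⟨.single ⟨i, hfragment⟩, _, _, .refl, hfragment⟩

theorem linkedWithLabel_of_partner_ne {a : Fin N ⊕ Fin N} (hap : a ≠ Sum.inl p)
    (haq : a ≠ Sum.inl q) (hp : M.partner a ≠ Sum.inl p) (hq : M.partner a ≠ Sum.inl q) :
    LinkedWithLabel (elementary N i) M.toArcs a (M.partner a) (M.label a) := by
  have hsnd := linked_outerNode_sndNode (M := M) hpq hap haq
  exact ⟨(hsnd.tail ⟨_, fragment_sndNode a⟩).trans (linked_outerNode_sndNode hpq hp hq).symm,
    _, _, hsnd, fragment_sndNode a⟩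

/-- The strand runs from `a` through the middle copies of `p` and `q` to the partner of `q`. -/
theorem linkedWithLabel_of_partner_eq {a : Fin N ⊕ Fin N} (haq : a ≠ Sum.inl q)
    (hp : M.partner a = Sum.inl p) :
    LinkedWithLabel (elementary N i) M.toArcs a (M.partner (Sum.inl q))
      (min (min (M.label (Sum.inl p)) (M.label (Sum.inl q))) i) := by
  have hap : a ≠ Sum.inl p := fun h => M.partner_ne a (hp.trans h.symm)
  have hqp : M.partner (Sum.inl q) ≠ Sum.inl p := fun h =>
    haq (by rw [← M.partner_partner a, hp, ← h, M.partner_partner])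
  have hmid : Fragment (elementary N i) M.toArcs (.mid p) (.mid q) i :=
    (fragment_elementary_iff hpq).2 (.inr (.inl ⟨rfl, .inr rfl⟩))
  have hlinkp : Linked (elementary N i) M.toArcs (outerNode a) (.mid p) :=
    (linked_outerNode_sndNode hpq hap haq).tail ⟨_, hp ▸ fragment_sndNode a⟩
  have hlinkq := hlinkp.tail ⟨i, hmid⟩
  refine ⟨(hlinkq.tail ⟨_, fragment_sndNode (Sum.inl q)⟩).trans
    (linked_outerNode_sndNode hpq hqp (M.partner_ne _)).symm, ?_⟩
  rcases min_choice (min (M.label (Sum.inl p)) (M.label (Sum.inl q))) i with hmin | hmin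
  · rcases min_choice (M.label (Sum.inl p)) (M.label (Sum.inl q)) with hmin' | hmin' <;>
      rw [hmin, hmin']
    exacts [⟨_, _, hlinkp, fragment_sndNode (Sum.inl p)⟩,
      ⟨_, _, hlinkq, fragment_sndNode (Sum.inl q)⟩]
  · rw [hmin]
    exact ⟨_, _, hlinkp, hmid⟩

theorem linkedWithLabel_join (a : Fin N ⊕ Fin N) :
    LinkedWithLabel (elementary N i) M.toArcs a ((M.join _ _ (inl_ne_inl hpq) i).partner a)
      ((M.join _ _ (inl_ne_inl hpq) i).label a) := by
  have hne := inl_ne_inl hpq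
  have hqp : s((q : ℕ) + 1, (p : ℕ) + 1) = s(i, i + 1) := Sym2.eq_swap.trans hpq
  by_cases hap : a = Sum.inl p
  · subst hap
    simpa [join] using linkedWithLabel_inl hpq
  by_cases haq : a = Sum.inl q
  · subst haq
    simpa [join, hne.symm] using linkedWithLabel_inl hqp
  by_cases hp : M.partner a = Sum.inl p
  · simpa [join, hap, haq, hp] using linkedWithLabel_of_partner_eq hpq haq hp
  by_cases hq : M.partner a = Sum.inl q
  · simpa [join, hap, haq, hq, hne.symm, min_comm (M.label (Sum.inl p))]
      using linkedWithLabel_of_partner_eq hqp hap hq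
  · simpa [join, hap, haq, hp, hq] using linkedWithLabel_of_partner_ne hpq hap haq hp hq

section

variable {α : Type*} {f : Fin N ⊕ Fin N → α} {d : α}
  (hf : ∀ a, f ((M.join _ _ (inl_ne_inl hpq) i).partner a) = f a)
  (hd : M.partner (Sum.inl p) ≠ Sum.inl q → d = f (M.partner (Sum.inl p)))

include hf hd

theorem glueExtend_eq_of_fragment (huv : Fragment (elementary N i) M.toArcs u v h) :
    glueExtend f p q d u = glueExtend f p q d v := by
  rw [fragment_elementary_iff hpq] at huv
  suffices hdiag : (s(u, v).map (glueExtend f p q d)).IsDiag from Sym2.mk_isDiag_iff.1 hdiag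
  rcases huv with ⟨j, hjp, hjq, -, huv⟩ | ⟨-, huv | huv⟩ | ⟨a, huv, -⟩ <;>
    rw [huv, Sym2.map_mk, Sym2.mk_isDiag_iff]
  · simp [glueExtend, hjp, hjq]
  · simpa [glueExtend, join] using (hf (Sum.inl p)).symm
  · simp [glueExtend]
  · rw [glueExtend_sndNode, glueExtend_sndNode]
    have hfa := hf a
    have hfp := hf (M.partner (Sum.inl p))
    have hinvol := M.partner_partner
    have hne := M.partner_ne
    simp only [join] at hfa hfp
    grind

theorem glueExtend_eq_of_linked (huv : Linked (elementary N i) M.toArcs u v) :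
    glueExtend f p q d u = glueExtend f p q d v := by
  induction huv with
  | refl => rfl
  | tail _ hvw ih => exact ih.trans (hvw.elim fun _ => glueExtend_eq_of_fragment hpq hf hd)

end

theorem eq_partner_join_of_linked {a b : Fin N ⊕ Fin N}
    (hab : Linked (elementary N i) M.toArcs (outerNode a) (outerNode b)) :
    a = b ∨ b = (M.join _ _ (inl_ne_inl hpq) i).partner a := by
  set M' := M.join _ _ (inl_ne_inl hpq) i with hM'
  have hpair := glueExtend_eq_of_linked hpq (f := fun a => s(a, M'.partner a))
    (d := s(M.partner (Sum.inl p), M'.partner (M.partner (Sum.inl p))))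
    (fun a => by rw [← hM', M'.partner_partner, Sym2.eq_swap]) (fun _ => rfl) hab
  rw [glueExtend_outerNode, glueExtend_outerNode, Sym2.eq_iff] at hpair
  exact hpair.imp And.left fun h => h.2.symm

theorem label_join_le_of_fragment (hM : ∀ j : Fin N, M.label (Sum.inl j) ≤ j + 1)
    {a : Fin N ⊕ Fin N} (hau : Linked (elementary N i) M.toArcs (outerNode a) u)
    (huv : Fragment (elementary N i) M.toArcs u v h) :
    (M.join _ _ (inl_ne_inl hpq) i).label a ≤ h := by
  have hinvol := M.partner_partner
  have hne := M.partner_ne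
  have hlabel := M.label_partner
  set M' := M.join _ _ (inl_ne_inl hpq) i with hM'
  obtain ⟨d, hd, hdle⟩ : ∃ d, (M.partner (Sum.inl p) ≠ Sum.inl q →
      d = M'.label (M.partner (Sum.inl p))) ∧
      d ≤ min (min (M.label (Sum.inl p)) (M.label (Sum.inl q))) i := by
    by_cases hpq' : M.partner (Sum.inl p) = Sum.inl q
    · exact ⟨0, fun h => (h hpq').elim, Nat.zero_le _⟩
    · refine ⟨_, fun _ => rfl, ?_⟩
      simp only [hM', join]
      grind
  have hle : ∀ a, glueExtend M'.label p q d (sndNode a) ≤ M.label a := by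
    intro a
    rw [glueExtend_sndNode]
    simp only [hM', join]
    grind
  set g := glueExtend M'.label p q d with hg
  have hau : M'.label a = g u := by
    rw [hg, ← glueExtend_eq_of_linked hpq M'.label_partner hd hau, glueExtend_outerNode]
  have huv' : g u = g v := glueExtend_eq_of_fragment hpq M'.label_partner hd huv
  rw [hau]
  suffices hend : ∃ x ∈ s(u, v), g x ≤ h by
    obtain ⟨x, hx, hgx⟩ := hend
    rcases Sym2.mem_iff.1 hx with rfl | rfl
    exacts [hgx, huv'.trans_le hgx]
  rcases (fragment_elementary_iff hpq).1 huv with ⟨j, -, -, rfl, he⟩ | ⟨rfl, he | he⟩ |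
      ⟨a, he, rfl⟩ <;> rw [he]
  · exact ⟨_, Sym2.mem_mk_right _ _, (hle (Sum.inl j)).trans (hM j)⟩
  · exact ⟨_, Sym2.mem_mk_left _ _, by simp [hg, glueExtend, hM', join]⟩
  · exact ⟨_, Sym2.mem_mk_left _ _, by simpa [hg, glueExtend] using hdle.trans (min_le_right _ _)⟩
  · exact ⟨_, Sym2.mem_mk_left _ _, hle a⟩

theorem comp_elementary_toArcs (hM : ∀ j : Fin N, M.label (Sum.inl j) ≤ j + 1) :
    comp (elementary N i) M.toArcs = (M.join _ _ (inl_ne_inl hpq) i).toArcs :=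
  comp_eq_toArcs (linkedWithLabel_join hpq) (fun _ _ => eq_partner_join_of_linked hpq)
    fun _ _ _ _ => label_join_le_of_fragment hpq hM

end LabelledArcs

/-! ## Arc-diagrams of words -/

section WordMatching

variable {N : ℕ}

/-- Joins the nodes `i` and `i + 1` of one side, given by `φ`, for `1 ≤ i < N`. -/
def sideJoin (φ : Fin N ↪ Fin N ⊕ Fin N) (i : ℕ) (M : LabelledMatching (Fin N ⊕ Fin N)) :
    LabelledMatching (Fin N ⊕ Fin N) :=
  if h : 1 ≤ i ∧ i < N then
    M.join (φ ⟨i - 1, by omega⟩) (φ ⟨i, h.2⟩)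
      (φ.injective.ne (Fin.ne_of_val_ne (by dsimp only; omega))) i
  else M

/-- The matching of the arc-diagram of a word. -/
def wordMatching (N : ℕ) (w : List ℕ) : LabelledMatching (Fin N ⊕ Fin N) :=
  w.foldr (sideJoin Function.Embedding.inl) (idMatching N)

theorem label_foldr_sideJoin_le (φ : Fin N ↪ Fin N ⊕ Fin N)
    {M : LabelledMatching (Fin N ⊕ Fin N)} (hM : ∀ j : Fin N, M.label (φ j) ≤ j + 1) (w : List ℕ)
    (j : Fin N) : (w.foldr (sideJoin φ) M).label (φ j) ≤ j + 1 := by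
  induction w generalizing j with
  | nil => exact hM j
  | cons i w ih =>
    rw [List.foldr_cons, sideJoin]
    split_ifs with hi
    · have hpartner := (w.foldr (sideJoin φ) M).label_partner (φ j)
      simp only [LabelledMatching.join, φ.injective.eq_iff]
      split_ifs with hend hthrough
      · simp only [Fin.ext_iff] at hend
        omega
      · refine le_trans ?_ (ih j)
        rw [← hpartner]
        rcases hthrough with h | h <;> rw [h]
        · exact (min_le_left _ _).trans (min_le_left _ _)
        · exact (min_le_left _ _).trans (min_le_right _ _)
      · exact ih j
    · exact ih j

theorem foldr_comp_eq_toArcs (w : List ℕ) (hw : ∀ i ∈ w, 1 ≤ i ∧ i < N) :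
    (w.map (LabelledArcs.elementary N)).foldr LabelledArcs.comp (LabelledArcs.identity N) =
      (wordMatching N w).toArcs := by
  induction w with
  | nil => exact (toArcs_idMatching N).symm
  | cons i w ih =>
    obtain ⟨h1, hN⟩ := hw i List.mem_cons_self
    have hends : s(i - 1 + 1, i + 1) = s(i, i + 1) := by rw [Nat.sub_add_cancel h1]
    rw [List.map_cons, List.foldr_cons, ih fun j hj => hw j (List.mem_cons_of_mem i hj),
      wordMatching,
      LabelledArcs.comp_elementary_toArcs (p := ⟨i - 1, by omega⟩) (q := ⟨i, hN⟩) hends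
        (label_foldr_sideJoin_le .inl (M := idMatching N) (fun _ => le_rfl) w)]
    rw [wordMatching, List.foldr_cons, sideJoin, dif_pos ⟨h1, hN⟩]
    rfl

theorem ofPerm_eq_toArcs (σ : Equiv.Perm (Fin N)) :
    LabelledArcs.ofPerm σ = (wordMatching N (permWord σ)).toArcs :=
  foldr_comp_eq_toArcs _ (permWord_range σ)

end WordMatching

section SideJoin

variable {N : ℕ} (φ : Fin N ↪ Fin N ⊕ Fin N) (M : LabelledMatching (Fin N ⊕ Fin N))

theorem exists_sideJoin_eq_join {i : ℕ} (hi : 1 ≤ i ∧ i < N) :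
    ∃ p q : Fin N, (p : ℕ) + 1 = i ∧ (q : ℕ) = i ∧
      ∃ hpq, sideJoin φ i M = M.join (φ p) (φ q) hpq i :=
  ⟨⟨i - 1, by omega⟩, ⟨i, hi.2⟩, Nat.sub_add_cancel hi.1, rfl, _, dif_pos hi⟩

theorem sideJoin_comm {i j : ℕ} (h : i + 2 ≤ j) :
    sideJoin φ i (sideJoin φ j M) = sideJoin φ j (sideJoin φ i M) := by
  simp only [sideJoin]
  split_ifs
  · refine (M.join_comm _ _ _ ?_ ?_ ?_ ?_ _).symm <;>
      refine φ.injective.ne (Fin.ne_of_val_ne ?_) <;> dsimp only <;> omega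
  all_goals rfl

theorem sideJoin_inl_inr (i j : ℕ) :
    sideJoin .inl i (sideJoin .inr j M) = sideJoin .inr j (sideJoin .inl i M) := by
  simp only [sideJoin]
  split_ifs
  · refine (M.join_comm _ _ _ ?_ ?_ ?_ ?_ _).symm <;> exact nofun
  all_goals rfl

theorem sideJoin_idMatching (i : ℕ) :
    sideJoin .inl i (idMatching N) = sideJoin .inr i (idMatching N) := by
  simp only [sideJoin]
  split_ifs
  · ext (v | v) <;> simp only [LabelledMatching.join, idMatching, Sum.swap_inl, Sum.swap_inr,
      Function.Embedding.inl_apply, Function.Embedding.inr_apply, Sum.elim_inl, Sum.elim_inr] <;>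
      grind
  · rfl

theorem foldr_sideJoin_comm (u v : List ℕ) :
    u.foldr (sideJoin .inl) (v.foldr (sideJoin .inr) M) =
      v.foldr (sideJoin .inr) (u.foldr (sideJoin .inl) M) := by
  have hletter : ∀ (i : ℕ) M, sideJoin .inl i (v.foldr (sideJoin .inr) M) =
      v.foldr (sideJoin (N := N) .inr) (sideJoin .inl i M) := by
    intro i M
    induction v with
    | nil => rfl
    | cons j v ih => rw [List.foldr_cons, List.foldr_cons, sideJoin_inl_inr, ih]
  induction u with
  | nil => rfl
  | cons i u ih => rw [List.foldr_cons, List.foldr_cons, ih, hletter]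

end SideJoin

section WordMatching

variable {N : ℕ}

theorem wordMatching_append_eq_foldr_inl (u v : List ℕ) :
    wordMatching N (u ++ v) = u.foldr (sideJoin .inl) (wordMatching N v) := List.foldr_append

theorem wordMatching_eq_foldr_inr (w : List ℕ) :
    wordMatching N w = w.reverse.foldr (sideJoin .inr) (idMatching N) := by
  induction w with
  | nil => rfl
  | cons i w ih =>
    rw [wordMatching, List.foldr_cons, ← wordMatching, ih, List.reverse_cons, List.foldr_append,
      List.foldr_cons, List.foldr_nil, ← sideJoin_idMatching]
    exact foldr_sideJoin_comm (idMatching N) [i] w.reverse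

theorem wordMatching_append_eq_foldr_inr (u v : List ℕ) :
    wordMatching N (u ++ v) = v.reverse.foldr (sideJoin .inr) (wordMatching N u) := by
  rw [wordMatching_append_eq_foldr_inl, wordMatching_eq_foldr_inr v, foldr_sideJoin_comm,
    wordMatching]

theorem label_wordMatching_le (w : List ℕ) (j : Fin N) :
    (wordMatching N w).label (.inl j) ≤ j + 1 :=
  label_foldr_sideJoin_le .inl (fun _ => le_rfl) w j

theorem label_wordMatching_inr_le (w : List ℕ) (j : Fin N) :
    (wordMatching N w).label (.inr j) ≤ j + 1 := by
  rw [wordMatching_eq_foldr_inr]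
  exact label_foldr_sideJoin_le .inr (fun _ => le_rfl) _ j

theorem TraceEq.wordMatching_eq {u v : List ℕ} (h : TraceEq u v) :
    wordMatching N u = wordMatching N v := by
  let join : ℕ → Function.End (LabelledMatching (Fin N ⊕ Fin N)) := fun i => sideJoin .inl i
  have eq_prod : ∀ w : List ℕ, wordMatching N w = (w.map join).prod (idMatching N) := by
    intro w
    induction w with
    | nil => rfl
    | cons i w ih =>
      rw [wordMatching, List.foldr_cons, ← wordMatching, ih, List.map_cons, List.prod_cons]
      rfl
  rw [eq_prod, eq_prod, h.prod_map_eq]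
  exact fun a b hab => funext fun M => sideJoin_comm _ M hab

end WordMatching

/-! ## Propagating labels -/

section CrossLabels

variable {N : ℕ} (φ : Fin N ↪ Fin N ⊕ Fin N) (M : LabelledMatching (Fin N ⊕ Fin N))

/-- The propagating labels of a matching, with multiplicity: the labels of the nodes outside the
side given by `φ` whose partner lies on that side. -/
def crossLabels : Multiset ℕ :=
  (Finset.univ.filter (fun v => v ∉ Set.range φ ∧ M.partner v ∈ Set.range φ)).val.map M.label

theorem crossLabels_inl_eq_inr : crossLabels .inl M = crossLabels .inr M := by
  let swap : (Fin N ⊕ Fin N) ≃ (Fin N ⊕ Fin N) := Function.Involutive.toPerm _ M.partner_partner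
  rw [crossLabels, ← Finset.map_univ_equiv swap, Finset.filter_map, Finset.map_val,
    Multiset.map_map, crossLabels]
  refine Multiset.map_congr (congrArg _ (Finset.filter_congr fun v _ => ?_))
    fun v _ => M.label_partner v
  have hpartner : M.partner (M.partner v) = v := M.partner_partner v
  have hswap : swap v = M.partner v := rfl
  rcases v with v | v <;> rcases h : M.partner _ with w | w <;> simp_all

theorem propLab_toArcs_eq : M.toArcs.propLab = {h | h ∈ crossLabels .inr M} := by
  ext h
  simp only [LabelledMatching.propLab_toArcs, crossLabels, Set.mem_ofPred_eq, Multiset.mem_map,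
    Finset.mem_val, Finset.mem_filter, Finset.mem_univ, true_and, Sum.exists]
  simp [eq_comm]

theorem countP_crossLabels (x : ℕ) : (crossLabels φ M).countP (x ≤ ·) = (Finset.univ.filter
    (fun v => (v ∉ Set.range φ ∧ M.partner v ∈ Set.range φ) ∧ x ≤ M.label v)).card := by
  rw [crossLabels, Multiset.countP_map, ← Finset.filter_filter _ (x ≤ M.label ·)]
  rfl

theorem countP_crossLabels_sideJoin_le (x i : ℕ) :
    (crossLabels φ (sideJoin φ i M)).countP (x ≤ ·) ≤ (crossLabels φ M).countP (x ≤ ·) := by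
  by_cases hi : 1 ≤ i ∧ i < N
  swap
  · rw [sideJoin, dif_neg hi]
  obtain ⟨p, q, -, -, hpq, hjoin⟩ := exists_sideJoin_eq_join φ M hi
  rw [hjoin, countP_crossLabels, countP_crossLabels]
  refine Finset.card_le_card fun v hv => ?_
  simp only [Finset.mem_filter, Finset.mem_univ, true_and] at hv ⊢
  obtain ⟨⟨hvφ, hpartner⟩, hx⟩ := hv
  have hv_ne : ∀ j, v ≠ φ j := fun j hj => hvφ ⟨j, hj.symm⟩
  have hlabel := M.label_partner v
  simp only [LabelledMatching.join, hv_ne, if_false, or_self] at hpartner hx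
  by_cases hp : M.partner v = φ p
  · rw [if_pos (.inl hp), ← hp, hlabel] at hx
    exact ⟨⟨hvφ, p, hp.symm⟩, by omega⟩
  by_cases hq : M.partner v = φ q
  · rw [if_pos (.inr hq), ← hq, hlabel] at hx
    exact ⟨⟨hvφ, q, hq.symm⟩, by omega⟩
  simp only [hp, hq, if_false, or_self] at hpartner hx
  exact ⟨⟨hvφ, hpartner⟩, hx⟩

theorem countP_crossLabels_foldr_le (x : ℕ) (w : List ℕ) :
    (crossLabels φ (w.foldr (sideJoin φ) M)).countP (x ≤ ·) ≤
      (crossLabels φ M).countP (x ≤ ·) := by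
  induction w with
  | nil => exact le_rfl
  | cons i w ih => exact (countP_crossLabels_sideJoin_le φ _ x i).trans ih

end CrossLabels

section SameCross

variable {N : ℕ} {φ : Fin N ↪ Fin N ⊕ Fin N} {M M' M'' : LabelledMatching (Fin N ⊕ Fin N)}

/-- `M'` arises from `M` by changes on the side given by `φ` that affect no propagating label. -/
structure SameCross (φ : Fin N ↪ Fin N ⊕ Fin N) (M M' : LabelledMatching (Fin N ⊕ Fin N)) :
    Prop where
  mem_iff : ∀ v ∉ Set.range φ, M'.partner v ∈ Set.range φ ↔ M.partner v ∈ Set.range φ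
  label_eq : ∀ v ∉ Set.range φ, M'.label v = M.label v
  partner_eq : ∀ v ∉ Set.range φ, M.partner v ∉ Set.range φ → M'.partner v = M.partner v

namespace SameCross

theorem refl (φ : Fin N ↪ Fin N ⊕ Fin N) (M : LabelledMatching (Fin N ⊕ Fin N)) :
    SameCross φ M M :=
  ⟨fun _ _ => Iff.rfl, fun _ _ => rfl, fun _ _ _ => rfl⟩

theorem trans (h : SameCross φ M M') (h' : SameCross φ M' M'') : SameCross φ M M'' where
  mem_iff v hv := (h'.mem_iff v hv).trans (h.mem_iff v hv)
  label_eq v hv := (h'.label_eq v hv).trans (h.label_eq v hv)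
  partner_eq v hv hpartner := by
    have heq := h.partner_eq v hv hpartner
    rw [h'.partner_eq v hv (by rwa [heq]), heq]

theorem crossLabels_eq (h : SameCross φ M M') : crossLabels φ M' = crossLabels φ M := by
  rw [crossLabels, crossLabels,
    Finset.filter_congr fun v _ => and_congr_right fun hv => h.mem_iff v hv]
  refine Multiset.map_congr rfl fun v hv => h.label_eq v ?_
  rw [Finset.mem_val, Finset.mem_filter] at hv
  exact hv.2.1

theorem join {p q : Fin N} (hpq : φ p ≠ φ q) {l : ℕ} (hq : M.partner (φ q) ∈ Set.range φ)
    (hlabel : M.label (φ p) ≤ M.label (φ q)) (hl : M.label (φ p) ≤ l) :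
    SameCross φ M (M.join (φ p) (φ q) hpq l) := by
  have hmin : min (min (M.label (φ p)) (M.label (φ q))) l = M.label (φ p) := by omega
  have hv_ne : ∀ v ∉ Set.range φ, ∀ j, v ≠ φ j := fun v hv j hj => hv ⟨j, hj.symm⟩
  have hpartner_ne : ∀ v ∉ Set.range φ, M.partner v ≠ φ q := fun v hv hvq =>
    hv (by rwa [← hvq, M.partner_partner] at hq)
  refine ⟨fun v hv => ?_, fun v hv => ?_, fun v hv hpartner => ?_⟩ <;>
    simp only [LabelledMatching.join, hmin, hv_ne v hv, hpartner_ne v hv, if_false, or_false]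
  · split_ifs with hp
    · simp only [hq, hp, Set.mem_range_self]
    · rfl
  · split_ifs with hp
    · rw [← hp, M.label_partner]
    · rfl
  · rw [if_neg fun hp => hpartner ⟨p, hp.symm⟩]

end SameCross

end SameCross

section SideInvariant

variable {N : ℕ} {φ : Fin N ↪ Fin N ⊕ Fin N} {w : List ℕ} {M : LabelledMatching (Fin N ⊕ Fin N)}

/-- The condition under which joining nodes of the side given by `φ`, along a reduced word that
continues `w`, leaves the propagating labels alone: labels are at most the height of their node,
and a node of height `j` pairs within the side, with the largest possible label, as soon as `j`
comes first among the letters `j - 1` and `j` of `w`. -/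
structure SideInvariant (φ : Fin N ↪ Fin N ⊕ Fin N) (w : List ℕ)
    (M : LabelledMatching (Fin N ⊕ Fin N)) : Prop where
  label_le : ∀ j : Fin N, M.label (φ j) ≤ j + 1
  first : ∀ j : Fin N, [(j : ℕ) + 1] <+: adjFilter j w →
    M.partner (φ j) ∈ Set.range φ ∧ M.label (φ j) = j + 1

namespace SideInvariant

theorem sameCross_sideJoin (hM : SideInvariant φ w M) {i : ℕ} (hi : 1 ≤ i ∧ i < N)
    (hfirst : [i + 1] <+: adjFilter i w) : SameCross φ M (sideJoin φ i M) := by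
  obtain ⟨p, q, hp, rfl, hpq, hjoin⟩ := exists_sideJoin_eq_join φ M hi
  obtain ⟨hpartner, hlabel⟩ := hM.first q hfirst
  have hle := hM.label_le p
  exact hjoin ▸ .join hpq hpartner (by omega) (by omega)

theorem cons_sideJoin (hM : SideInvariant φ w M) {i : ℕ} (hi : 1 ≤ i ∧ i < N)
    (hfirst : [i + 1] <+: adjFilter i w) : SideInvariant φ (i :: w) (sideJoin φ i M) where
  label_le := label_foldr_sideJoin_le φ hM.label_le [i]
  first j hj := by
    obtain ⟨p, q, hp, rfl, hpq, hjoin⟩ := exists_sideJoin_eq_join φ M hi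
    obtain ⟨hqpartner, hqlabel⟩ := hM.first q hfirst
    have hple := hM.label_le p
    have hjq : j ≠ q := by
      rintro rfl
      rw [adjFilter_cons_self, List.cons_prefix_cons] at hj
      omega
    rw [hjoin]
    by_cases hjp : j = p
    · subst hjp
      simp [LabelledMatching.join, hp]
    have hfar : ¬ ((q : ℕ) = j ∨ (q : ℕ) = j + 1) := by
      simp only [ne_eq, Fin.ext_iff] at hjq hjp
      omega
    rw [adjFilter_cons, if_neg hfar] at hj
    obtain ⟨hjpartner, hjlabel⟩ := hM.first j hj
    have hlabel := M.label_partner (φ j)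
    simp only [LabelledMatching.join, φ.injective.eq_iff, hjp, hjq, if_false, or_self]
    by_cases hthrough : M.partner (φ j) = φ p
    · rw [hthrough] at hlabel
      rw [if_pos hthrough, if_pos (.inl hthrough)]
      exact ⟨hqpartner, by omega⟩
    have hne : M.partner (φ j) ≠ φ q := by
      intro hback
      rw [hback] at hlabel
      rw [← Fin.val_ne_iff] at hjq
      omega
    simp only [hthrough, hne, if_false, or_self]
    exact ⟨hjpartner, hjlabel⟩

end SideInvariant

theorem EndsIn.of_cons {F : Finset ℕ} {i : ℕ} {ρ : List ℕ} (h : EndsIn F (i :: ρ)) :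
    EndsIn F ρ :=
  fun c hc => h c (hc.trans ((List.suffix_cons i ρ).filter _))

theorem EndsIn.prefix_adjFilter {F : Finset ℕ} {i : ℕ} {ρ : List ℕ} (h : EndsIn F (i :: ρ))
    (hF : ∀ a ∈ F, a ∈ w) (hred : ReducedWord (i :: (ρ ++ w))) :
    [i + 1] <+: adjFilter i (ρ ++ w) := by
  have hred_i := hred i
  rw [adjFilter_cons_self] at hred_i
  rcases hfilter : adjFilter i (ρ ++ w) with _ | ⟨a, l⟩
  · have hnone : ∀ a, a = i ∨ a = i + 1 → a ∉ F := by
      intro a ha haF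
      have hmem := mem_adjFilter.2 ⟨List.mem_append_right ρ (hF a haF), ha⟩
      rw [hfilter] at hmem
      exact List.not_mem_nil hmem
    rw [adjFilter_append, List.append_eq_nil_iff] at hfilter
    rcases h i (by rw [adjFilter_cons_self, hfilter.1]) with hi | hi
    exacts [(hnone i (.inl rfl) hi).elim, (hnone (i + 1) (.inr rfl) hi).elim]
  · rw [hfilter] at hred_i
    have ha : a ∈ adjFilter i (ρ ++ w) := hfilter ▸ List.mem_cons_self
    rcases (mem_adjFilter.1 ha).2 with rfl | rfl
    · exact (hred_i ⟨[], l, rfl⟩).elim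
    · exact ⟨l, rfl⟩

theorem SideInvariant.foldr {F : Finset ℕ} (hM : SideInvariant φ w M) (hF : ∀ a ∈ F, a ∈ w)
    {ρ : List ℕ} (hρ : ∀ i ∈ ρ, 1 ≤ i ∧ i < N) (hred : ReducedWord (ρ ++ w)) (hend : EndsIn F ρ) :
    SideInvariant φ (ρ ++ w) (ρ.foldr (sideJoin φ) M) ∧
      SameCross φ M (ρ.foldr (sideJoin φ) M) := by
  induction ρ with
  | nil => exact ⟨hM, .refl φ M⟩
  | cons i ρ ih =>
    obtain ⟨hinv, hsame⟩ := ih (fun j hj => hρ j (List.mem_cons_of_mem i hj))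
      (hred.of_append_right (u := [i])) hend.of_cons
    have hi := hρ i List.mem_cons_self
    have hfirst := hend.prefix_adjFilter hF hred
    exact ⟨hinv.cons_sideJoin hi hfirst, hsame.trans (hinv.sameCross_sideJoin hi hfirst)⟩

end SideInvariant

/-! ## The propagating labels of a triangular word -/

section FreeWord

variable {N : ℕ}

theorem wordMatching_inl_of_notMem {w : List ℕ} {j : Fin N} (hj : (j : ℕ) ∉ w)
    (hj' : (j : ℕ) + 1 ∉ w) :
    (wordMatching N w).partner (.inl j) = .inr j ∧ (wordMatching N w).label (.inl j) = j + 1 := by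
  induction w with
  | nil => exact ⟨rfl, rfl⟩
  | cons i w ih =>
    rw [List.mem_cons, not_or] at hj hj'
    obtain ⟨hpartner, hlabel⟩ := ih hj.2 hj'.2
    rw [wordMatching, List.foldr_cons, ← wordMatching]
    by_cases hi : 1 ≤ i ∧ i < N
    · obtain ⟨p, q, hp, hq, hpq, hjoin⟩ := exists_sideJoin_eq_join .inl (wordMatching N w) hi
      have hjp : j ≠ p := by rintro rfl; exact hj'.1 hp
      have hjq : j ≠ q := by rintro rfl; exact hj.1 hq
      simp [hjoin, LabelledMatching.join, hpartner, hlabel, hjp, hjq]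
    · rw [sideJoin, dif_neg hi]
      exact ⟨hpartner, hlabel⟩

namespace FibonacciSet

variable (S : FibonacciSet N)

theorem traceEq_freeWord_of_perm {w : List ℕ} (h : S.freeWord.Perm w) :
    TraceEq S.freeWord w := by
  intro c
  have hfilter : (adjFilter c S.freeWord).Perm (adjFilter c w) := h.filter _
  rcases S.adjFilter_freeWord c with hc | ⟨a, hc⟩ <;> rw [hc] at hfilter ⊢
  · exact hfilter.nil_eq
  · exact hfilter.singleton_eq

theorem wordMatching_freeWord_of_mem_freeSet {p q : Fin N} (hpq : (p : ℕ) + 1 = q)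
    (hq : (q : ℕ) ∈ S.freeSet) :
    ((wordMatching N S.freeWord).partner (.inl p) = .inl q ∧
      (wordMatching N S.freeWord).label (.inl p) = q) ∧
    ((wordMatching N S.freeWord).partner (.inr p) = .inr q ∧
      (wordMatching N S.freeWord).label (.inr p) = q) := by
  have hmem : ∀ i ∈ S.freeWord.erase q, i ≠ q ∧ i ∈ S.freeSet := fun i hi => by
    rwa [S.nodup_freeWord.mem_erase_iff, mem_freeWord] at hi
  have hp : (p : ℕ) ∉ S.freeWord.erase q := fun h =>
    succ_notMem_freeSet (hmem _ h).2 (hpq ▸ hq)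
  have hq' : (q : ℕ) ∉ S.freeWord.erase q := fun h => (hmem _ h).1 rfl
  have hq'' : (q : ℕ) + 1 ∉ S.freeWord.erase q := fun h => succ_notMem_freeSet hq (hmem _ h).2
  rw [(S.traceEq_freeWord_of_perm (List.perm_cons_erase (mem_freeWord.2 hq))).wordMatching_eq,
    wordMatching, List.foldr_cons, ← wordMatching]
  obtain ⟨hpp, hpl⟩ := wordMatching_inl_of_notMem hp (hpq ▸ hq')
  obtain ⟨hqp, hql⟩ := wordMatching_inl_of_notMem hq' hq''
  generalize wordMatching N (S.freeWord.erase q) = M at *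
  obtain ⟨r, s, hr, hs, hrs, hjoin⟩ :=
    exists_sideJoin_eq_join .inl M (S.forall_mem_freeWord q (mem_freeWord.2 hq))
  obtain rfl : r = p := Fin.ext (by omega)
  obtain rfl : s = q := Fin.ext hs
  have hrp : M.partner (.inr r) = .inl r := by rw [← hpp, M.partner_partner]
  rw [hjoin]
  simp [LabelledMatching.join, hrp, hqp, hpl, hql, hpq]

theorem wordMatching_freeWord_of_mem_carrier {j : Fin N} (hj : (j : ℕ) + 1 ∈ S.carrier) :
    (wordMatching N S.freeWord).partner (.inl j) = .inr j ∧
      (wordMatching N S.freeWord).label (.inl j) = j + 1 :=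
  wordMatching_inl_of_notMem
    (fun h => succ_notMem_carrier_of_mem_freeSet (mem_freeWord.1 h) hj)
    (fun h => notMem_carrier_of_mem_freeSet (mem_freeWord.1 h) hj)

theorem exists_partner_freeWord_eq_inl {j : Fin N} (hj : (j : ℕ) + 1 ∉ S.carrier) :
    ∃ k, (wordMatching N S.freeWord).partner (.inl j) = .inl k := by
  by_cases hfree : (j : ℕ) + 1 ∈ S.freeSet
  · exact ⟨⟨j + 1, lt_of_mem_freeSet hfree⟩,
      (S.wordMatching_freeWord_of_mem_freeSet rfl hfree).1.1⟩
  · obtain ⟨i, hi, hij⟩ := exists_succ_eq_of_notMem (by omega) j.isLt hj hfree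
    obtain rfl : i = j := by omega
    have hj1 := one_le_of_mem_freeSet hi
    let p : Fin N := ⟨j - 1, by omega⟩
    have hp := (S.wordMatching_freeWord_of_mem_freeSet (p := p) (Nat.sub_add_cancel hj1) hi).1.1
    exact ⟨p, by rw [← hp, LabelledMatching.partner_partner]⟩

theorem crossLabels_freeWord : crossLabels .inr (wordMatching N S.freeWord) = S.carrier.val := by
  have hcross : Finset.univ.filter (fun v => v ∉ Set.range (Function.Embedding.inr (α := Fin N)) ∧
      (wordMatching N S.freeWord).partner v ∈ Set.range Function.Embedding.inr) =
      (Finset.univ.filter fun j : Fin N => (j : ℕ) + 1 ∈ S.carrier).map .inl := by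
    ext (j | j)
    · by_cases hj : (j : ℕ) + 1 ∈ S.carrier
      · simp [hj, (S.wordMatching_freeWord_of_mem_carrier hj).1]
      · obtain ⟨k, hk⟩ := S.exists_partner_freeWord_eq_inl hj
        simp [hj, hk]
    · simp
  have hcarrier : S.carrier = (Finset.univ.filter fun j : Fin N => (j : ℕ) + 1 ∈ S.carrier).map
      (Fin.valEmbedding.trans ⟨Nat.succ, Nat.succ_injective⟩) := by
    ext s
    simp only [Finset.mem_map, Finset.mem_filter, Finset.mem_univ, true_and]
    constructor
    · intro hs
      have hs1 := one_le_of_mem hs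
      have hsN := le_of_mem hs
      exact ⟨⟨s - 1, by omega⟩, by simpa [Nat.sub_add_cancel hs1], Nat.sub_add_cancel hs1⟩
    · rintro ⟨j, hj, rfl⟩
      exact hj
  rw [crossLabels, hcross, Finset.map_val, Multiset.map_map]
  conv_rhs => rw [hcarrier, Finset.map_val]
  refine Multiset.map_congr rfl fun j hj => ?_
  rw [Finset.mem_val, Finset.mem_filter] at hj
  exact (S.wordMatching_freeWord_of_mem_carrier hj.2).2

theorem sideInvariant_inl_freeWord :
    SideInvariant .inl S.freeWord (wordMatching N S.freeWord) where
  label_le := label_wordMatching_le S.freeWord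
  first j hj := by
    have hfree := mem_freeWord.1 (mem_adjFilter.1 (hj.mem (List.mem_singleton_self _))).1
    obtain ⟨⟨hpartner, hlabel⟩, -⟩ := S.wordMatching_freeWord_of_mem_freeSet
      (q := ⟨j + 1, lt_of_mem_freeSet hfree⟩) rfl hfree
    exact ⟨⟨_, hpartner.symm⟩, hlabel⟩

theorem sideInvariant_inr_of_sameCross {M : LabelledMatching (Fin N ⊕ Fin N)}
    (hle : ∀ j : Fin N, M.label (.inr j) ≤ j + 1)
    (hM : SameCross .inl (wordMatching N S.freeWord) M) : SideInvariant .inr S.freeWord M where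
  label_le := hle
  first j hj := by
    have hfree := mem_freeWord.1 (mem_adjFilter.1 (hj.mem (List.mem_singleton_self _))).1
    obtain ⟨-, hpartner, hlabel⟩ := S.wordMatching_freeWord_of_mem_freeSet
      (q := ⟨j + 1, lt_of_mem_freeSet hfree⟩) rfl hfree
    have hj_right : (.inr j : Fin N ⊕ Fin N) ∉ Set.range Function.Embedding.inl := by simp
    refine ⟨⟨_, hpartner.symm.trans (hM.partner_eq _ hj_right ?_).symm⟩,
      (hM.label_eq _ hj_right).trans hlabel⟩
    simp [hpartner]

end FibonacciSet

end FreeWord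

namespace TriangularWord

variable {N : ℕ} {w ρ τ : List ℕ} {S : FibonacciSet N}

theorem crossLabels_eq (h : TriangularWord w S ρ τ) (hred : ReducedWord w)
    (hw : ∀ i ∈ w, 1 ≤ i ∧ i < N) : crossLabels .inr (wordMatching N w) = S.carrier.val := by
  have hred_factors : ReducedWord (ρ ++ S.freeWord ++ τ) := h.traceEq.reducedWord hred
  have mem_freeWord : ∀ a ∈ S.freeSet, a ∈ S.freeWord := fun a => FibonacciSet.mem_freeWord.2
  have same_left : SameCross .inl (wordMatching N S.freeWord)
      (wordMatching N (ρ ++ S.freeWord)) := by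
    rw [wordMatching_append_eq_foldr_inl]
    exact (S.sideInvariant_inl_freeWord.foldr mem_freeWord (h.forall_mem_left hw)
      hred_factors.of_append_left h.left).2
  have hred_right : ReducedWord (τ.reverse ++ S.freeWord) := by
    rw [List.append_assoc] at hred_factors
    have hreverse := hred_factors.of_append_right.reverse
    rw [List.reverse_append] at hreverse
    exact ((S.traceEq_freeWord_of_perm (List.reverse_perm _).symm).symm.append_left
      τ.reverse).reducedWord hreverse
  have same_right : SameCross .inr (wordMatching N (ρ ++ S.freeWord))
      (wordMatching N (ρ ++ S.freeWord ++ τ)) := by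
    rw [wordMatching_append_eq_foldr_inr _ τ]
    exact ((S.sideInvariant_inr_of_sameCross (label_wordMatching_inr_le _) same_left).foldr
      mem_freeWord (fun i hi => h.forall_mem_right hw i (List.mem_reverse.1 hi))
      hred_right h.right).2
  calc crossLabels .inr (wordMatching N w)
    _ = crossLabels .inr (wordMatching N (ρ ++ S.freeWord ++ τ)) := by
      rw [h.traceEq.wordMatching_eq]
    _ = crossLabels .inr (wordMatching N (ρ ++ S.freeWord)) := same_right.crossLabels_eq
    _ = crossLabels .inl (wordMatching N (ρ ++ S.freeWord)) := (crossLabels_inl_eq_inr _).symm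
    _ = crossLabels .inl (wordMatching N S.freeWord) := same_left.crossLabels_eq
    _ = crossLabels .inr (wordMatching N S.freeWord) := crossLabels_inl_eq_inr _
    _ = S.carrier.val := S.crossLabels_freeWord

end TriangularWord

section

variable {N : ℕ} {S A : FibonacciSet N} {u v α β ρ τ : List ℕ}

theorem TriangularWord.countGe_carrier {w : List ℕ} (h : TriangularWord w S ρ τ)
    (hred : ReducedWord w) (hw : ∀ i ∈ w, 1 ≤ i ∧ i < N) (x : ℕ) :
    countGe S.carrier x = (crossLabels .inr (wordMatching N w)).countP (x ≤ ·) := by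
  rw [h.crossLabels_eq hred hw, Multiset.countP_eq_card_filter]
  rfl

theorem TriangularWord.le_of_append_left (h : TriangularWord (u ++ v) S ρ τ)
    (hu : TriangularWord u A α β) (hred : ReducedWord (u ++ v))
    (hw : ∀ i ∈ u ++ v, 1 ≤ i ∧ i < N) : S ≤ A := by
  rw [FibonacciSet.le_iff_forall_countGe_le]
  intro x _
  rw [h.countGe_carrier hred hw, hu.countGe_carrier hred.of_append_left
    fun i hi => hw i (List.mem_append_left v hi), wordMatching_append_eq_foldr_inr]
  exact countP_crossLabels_foldr_le _ _ x _

theorem TriangularWord.le_of_append_right (h : TriangularWord (u ++ v) S ρ τ)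
    (hv : TriangularWord v A α β) (hred : ReducedWord (u ++ v))
    (hw : ∀ i ∈ u ++ v, 1 ≤ i ∧ i < N) : S ≤ A := by
  rw [FibonacciSet.le_iff_forall_countGe_le]
  intro x _
  rw [h.countGe_carrier hred hw, hv.countGe_carrier hred.of_append_right
    fun i hi => hw i (List.mem_append_right u hi), wordMatching_append_eq_foldr_inl,
    ← crossLabels_inl_eq_inr, ← crossLabels_inl_eq_inr]
  exact countP_crossLabels_foldr_le _ _ x _

end

/-! ## Triangular factorizations of permutations -/

/-- A triangular factorization `E_σ = E_ρ E_S E_τ`, read off from the words of the permutations. -/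
def TriangularPerm {N : ℕ} (σ : Equiv.Perm (Fin N)) (S : FibonacciSet N)
    (ρ τ : Equiv.Perm (Fin N)) : Prop :=
  TriangularWord (permWord σ) S (permWord ρ) (permWord τ)

theorem exists_triangularPerm {N : ℕ} (σ : Equiv.Perm (Fin N)) :
    ∃ S ρ τ, TriangularPerm σ S ρ τ := by
  have hred := reducedWord_permWord σ
  obtain ⟨S, u, v, h⟩ := hred.exists_triangularWord (permWord_range σ)
  have hred_factors := h.traceEq.reducedWord hred
  obtain ⟨ρ, hρ⟩ := hred_factors.of_append_left.of_append_left.exists_perm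
    (h.forall_mem_left (permWord_range σ))
  obtain ⟨τ, hτ⟩ := hred_factors.of_append_right.exists_perm
    (h.forall_mem_right (permWord_range σ))
  exact ⟨S, ρ, τ, h.of_traceEq (.refl _) hρ hτ⟩

theorem okadaWord_factors {K : Type*} [Field K] {N : ℕ} (X : Fin (N - 1) → K)
    (Y : Fin (N - 2) → K) (ρ τ : Equiv.Perm (Fin N)) (S : FibonacciSet N) :
    okadaWord X Y (permWord ρ ++ S.freeWord ++ permWord τ) =
      okadaPerm N X Y ρ * okadaFree N X Y S * okadaPerm N X Y τ := by
  rw [okadaWord_append, okadaWord_append]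
  rfl

namespace TriangularPerm

variable {N : ℕ} {σ ρ τ : Equiv.Perm (Fin N)} {S : FibonacciSet N}

theorem carrier_eq_propLab (h : TriangularPerm σ S ρ τ) :
    (S.carrier : Set ℕ) = (LabelledArcs.ofPerm σ).propLab := by
  rw [ofPerm_eq_toArcs, propLab_toArcs_eq,
    h.crossLabels_eq (reducedWord_permWord σ) (permWord_range σ)]
  rfl

theorem permLength_eq (h : TriangularPerm σ S ρ τ) :
    permLength σ = S.freeSet.card + permLength ρ + permLength τ := by
  have hlength := h.traceEq.perm.length_eq
  simp only [List.length_append, length_permWord, FibonacciSet.length_freeWord] at hlength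
  omega

theorem le_inf (h : TriangularPerm σ S ρ τ) {A B I : FibonacciSet N}
    {ρ₁ ρ₂ τ₁ τ₂ : Equiv.Perm (Fin N)} (hA : TriangularPerm ρ A ρ₁ ρ₂)
    (hB : TriangularPerm τ B τ₁ τ₂) (hI : IsGLB {A, B} I) : S ≤ I := by
  have hred := h.traceEq.reducedWord (reducedWord_permWord σ)
  have hrange : ∀ i ∈ permWord ρ ++ S.freeWord ++ permWord τ, 1 ≤ i ∧ i < N := fun i hi =>
    permWord_range σ i ((h.traceEq.mem_iff i).2 hi)
  have hfactors : TriangularWord (permWord ρ ++ S.freeWord ++ permWord τ) S _ _ :=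
    h.of_traceEq h.traceEq.symm (.refl _) (.refl _)
  refine hI.2 ?_
  rintro C (rfl | rfl)
  · rw [List.append_assoc] at hred hrange hfactors
    exact hfactors.le_of_append_left hA hred hrange
  · exact hfactors.le_of_append_right hB hred hrange

section Okada

variable {K : Type*} [Field K] (X : Fin (N - 1) → K) (Y : Fin (N - 2) → K)

theorem okadaPerm_eq (h : TriangularPerm σ S ρ τ) :
    okadaPerm N X Y σ = okadaPerm N X Y ρ * okadaFree N X Y S * okadaPerm N X Y τ := by
  rw [okadaPerm_eq_okadaWord, h.traceEq.okadaWord_eq, okadaWord_factors]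

theorem unique (h : TriangularPerm σ S ρ τ) {ρ' τ' : Equiv.Perm (Fin N)}
    (hfactor : okadaPerm N X Y σ = okadaPerm N X Y ρ' * okadaFree N X Y S * okadaPerm N X Y τ')
    (hlength : permLength σ = S.freeSet.card + permLength ρ' + permLength τ') :
    ρ' = ρ ∧ τ' = τ := by
  have hrange : ∀ i ∈ permWord ρ' ++ S.freeWord ++ permWord τ', 1 ≤ i ∧ i < N := by
    simp only [List.mem_append]
    rintro i ((hi | hi) | hi)
    exacts [permWord_range ρ' i hi, S.forall_mem_freeWord i hi, permWord_range τ' i hi]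
  have hlen : (permWord σ).length = (permWord ρ' ++ S.freeWord ++ permWord τ').length := by
    simp only [List.length_append, length_permWord, FibonacciSet.length_freeWord]
    omega
  have htrace : TraceEq (permWord σ) (permWord ρ' ++ S.freeWord ++ permWord τ') :=
    (reducedWord_permWord σ).traceEq_of_okadaWord_eq X Y (permWord_range σ) hrange hlen
      (hfactor.trans (okadaWord_factors X Y ρ' τ' S).symm)
  obtain ⟨hρ, hτ⟩ := TriangularWord.unique h (reducedWord_permWord σ) htrace
  exact ⟨perm_eq_of_traceEq_permWord hρ, perm_eq_of_traceEq_permWord hτ⟩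

end Okada

end TriangularPerm

theorem mainTheorem6 {K : Type*} [Field K] (N : ℕ) (X : Fin (N - 1) → K) (Y : Fin (N - 2) → K)
    (σ : Equiv.Perm (Fin N)) :
    ∃ S : FibonacciSet N, (S.carrier : Set ℕ) = LabelledArcs.propLab (LabelledArcs.ofPerm σ) ∧
      ∃ ρ τ : Equiv.Perm (Fin N),
        okadaPerm N X Y σ = okadaPerm N X Y ρ * okadaFree N X Y S * okadaPerm N X Y τ ∧
        permLength σ = S.freeSet.card + permLength ρ + permLength τ ∧
        (∃ A B I : FibonacciSet N,
          (A.carrier : Set ℕ) = LabelledArcs.propLab (LabelledArcs.ofPerm ρ) ∧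
          (B.carrier : Set ℕ) = LabelledArcs.propLab (LabelledArcs.ofPerm τ) ∧
          IsGLB {A, B} I ∧ S ≤ I) ∧
        ∀ ρ' τ' : Equiv.Perm (Fin N),
          okadaPerm N X Y σ = okadaPerm N X Y ρ' * okadaFree N X Y S * okadaPerm N X Y τ' →
          permLength σ = S.freeSet.card + permLength ρ' + permLength τ' →
          ρ' = ρ ∧ τ' = τ := by
  obtain ⟨S, ρ, τ, h⟩ := exists_triangularPerm σ
  obtain ⟨A, _, _, hA⟩ := exists_triangularPerm ρ
  obtain ⟨B, _, _, hB⟩ := exists_triangularPerm τ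
  obtain ⟨I, hI⟩ := FibonacciSet.exists_isGLB_pair A B
  exact ⟨S, h.carrier_eq_propLab, ρ, τ, h.okadaPerm_eq X Y, h.permLength_eq,
    ⟨A, B, I, hA.carrier_eq_propLab, hB.carrier_eq_propLab, hI, h.le_inf hA hB hI⟩,
    fun _ _ => h.unique X Y⟩
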